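/- **Pretorsion theories.** A *pretorsion theory* $(\mathbb C,\mathcal T,\mathcal F)$ consists of a category $\mathbb C$ and two full replete subcategories $\mathcal T$ (torsion objects) and $\mathcal F$ (torsion-free objects) of $\mathbb C$ such that, calling a morphism *null* when it factors through an object of $\mathcal T\cap\mathcal F$: (T1) every morphism from an object of $\mathcal T$ to an object of $\mathcal F$ is null; (T2) for every object $X$ there is a short exact sequence $T^X\xrightarrow{\ell^X}X\xrightarrow{r^X}F^X$ with $T^X\in\mathcal T$ and $F^X\in\mathcal F$. Here $A\xrightarrow{l}X\xrightarrow{r}B$ is *short exact* if $l$ is a kernel of $r$ and $r$ is a cokernel of $l$ relative to null morphisms: $r l$ is null, every $g$ into $X$ with $r g$ null factors uniquely through $l$, and every $g$ out of $X$ with $g l$ null factors uniquely through $r$. A pretorsion theory is always equipped with a choice of such a short exact sequence for every $X$, with $T^X=X$, $\ell^X=\mathrm{id}$ if $X\in\mathcal T$, and $F^X=X$, $r^X=\mathrm{id}$ if $X\in\mathcal F$. For $h\colon X\to Y$ let $h^T\colon T^X\to T^Y$ and $h^F\colon F^X\to F^Y$ be the unique morphisms with $\ell^Yh^T=h\,\ell^X$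 and $h^Fr^X=r^Yh$. The pretorsion theory is *rectangular* if the functor $\Gamma\colon\mathbb C\to\mathcal T\times\mathcal F$, $X\mapsto(T^X,F^X)$, $h\mapsto(h^T,h^F)$, is an equivalence of categories. A *rectangular torsion theory* is a rectangular pretorsion theory $(\mathbb C,\mathcal T,\mathcal F)$ such that $\mathbb C$ is pointed (it has a zero object) and the objects of $\mathcal T\cap\mathcal F$ are exactly the zero objects of $\mathbb C$. **2-categories.** $\mathbf{PointCat}$ is the (strict) 2-category of pointed categories, functors that preserve zero objects, and all natural transformations. $\mathbf{Tor}_{\mathrm R}$ is the 2-category whose objects are rectangular torsion theories, whose 1-cells $(\mathbb C,\mathcal T,\mathcal F)\to(\mathbb C',\mathcal T',\mathcal F')$ are the functors $\mathbb C\to\mathbb C'$ that preserve torsion objects and torsion-free objects and send the chosen short exact sequences to (not necessarily chosen) short exact sequences, and whose 2-cells are all natural transformations. Such functors preserve zero objects, so there is a forgetful 2-functor $\mathbf{Tor}_{\mathrm R}\to\mathbf{PointCat}$. **The 2-monad.** The 2-functor $M^\ast\colon\mathbf{PointCat}\to\mathbf{PointCat}$, $\mathbb C\mapsto\mathbb C\times\mathbb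 C$, $G\mapsto G\times G$, $\alpha\mapsto\alpha\times\alpha$, is a strict 2-monad, with unit the diagonal functor $\eta_{\mathbb C}\colon\mathbb C\to\mathbb C\times\mathbb C$ and multiplication the projection $\mu_{\mathbb C}=\pi_{1,4}\colon(\mathbb C\times\mathbb C)\times(\mathbb C\times\mathbb C)\to\mathbb C\times\mathbb C$ on the first and fourth components. A *pseudo-algebra* for $M^\ast$ is $(\mathbb C,Q,Q_\mu,Q_\eta)$ with $Q\colon\mathbb C\times\mathbb C\to\mathbb C$ a 1-cell of $\mathbf{PointCat}$ and $Q_\mu\colon Q\circ(Q\times Q)\Rightarrow Q\circ\pi_{1,4}$, $Q_\eta\colon\mathrm{Id}_{\mathbb C}\Rightarrow Q\circ\eta_{\mathbb C}$ natural isomorphisms satisfying the usual associativity and left and right unit coherence axioms. A *pseudo-morphism* $(\mathbb C,Q,Q_\mu,Q_\eta)\to(\mathbb D,R,R_\mu,R_\eta)$ is a pair $(G,\varphi)$ of a 1-cell $G\colon\mathbb C\to\mathbb D$ of $\mathbf{PointCat}$ and a natural isomorphism $\varphi\colon R\circ(G\times G)\Rightarrow G\circ Q$ compatible with $Q_\mu,R_\mu$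 and with $Q_\eta,R_\eta$. A 2-cell $(G,\varphi)\Rightarrow(H,\psi)$ is a natural transformation $\alpha\colon G\Rightarrow H$ such that $\psi\cdot(R\ast(\alpha\times\alpha))=(\alpha\ast Q)\cdot\varphi$. These form a 2-category $\mathrm{Ps}\text{-}\mathrm{Alg}(M^\ast)$ with a forgetful 2-functor to $\mathbf{PointCat}$. Its objects are also called the *internal rectangular bands* in $\mathbf{PointCat}$. **Theorem.** The 2-category $\mathbf{Tor}_{\mathrm R}$ of rectangular torsion theories is 2-equivalent, over $\mathbf{PointCat}$, to the 2-category $\mathrm{Ps}\text{-}\mathrm{Alg}(M^\ast)$ of pseudo-algebras and pseudo-morphisms of $M^\ast$, that is, to the 2-category of internal rectangular bands in $\mathbf{PointCat}$. Explicitly, there are 2-functors $\chi\colon\mathbf{Tor}_{\mathrm R}\to\mathrm{Ps}\text{-}\mathrm{Alg}(M^\ast)$ and $\xi\colon\mathrm{Ps}\text{-}\mathrm{Alg}(M^\ast)\to\mathbf{Tor}_{\mathrm R}$ that commute strictly with the forgetful 2-functors to $\mathbf{PointCat}$, together with 2-natural isomorphisms $\mathrm{Id}\cong\xi\circ\chi$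 and $\chi\circ\xi\cong\mathrm{Id}$ whose components have identity functors as underlying 1-cells of $\mathbf{PointCat}$. -/

import Mathlib

open CategoryTheory Bicategory Limits

universe w w₁ w₂ w₃ v v₁ v₂ v₃ u u₁ u₂ u₃

namespace RTT

/-! ### Strict 2-categories, 2-functors and 2-natural transformations

A strict 2-category is a bicategory `B` with `Bicategory.Strict B`, and a 2-functor is a
`StrictPseudofunctor`. -/

section TwoCategories

variable {B : Type u₁} [Bicategory.{w₁, v₁} B] {C : Type u₂} [Bicategory.{w₂, v₂} C]

/-- A (strict) 2-natural transformation between 2-functors. -/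
structure TwoNatTrans (F G : StrictPseudofunctor B C) where
  /-- the 1-cell components -/
  app (a : B) : F.obj a ⟶ G.obj a
  /-- strict naturality with respect to 1-cells -/
  naturality {a b : B} (f : a ⟶ b) : F.map f ≫ app b = app a ≫ G.map f
  /-- naturality with respect to 2-cells -/
  naturality₂ {a b : B} {f g : a ⟶ b} (θ : f ⟶ g) :
    F.map₂ θ ▷ app b ≫ eqToHom (naturality g) = eqToHom (naturality f) ≫ app a ◁ G.map₂ θ

/-- A 2-natural isomorphism: a 2-natural transformation with a strict inverse. -/
structure TwoNatIso (F G : StrictPseudofunctor B C) where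
  hom : TwoNatTrans F G
  inv : TwoNatTrans G F
  hom_inv_id (a : B) : hom.app a ≫ inv.app a = 𝟙 (F.obj a)
  inv_hom_id (a : B) : inv.app a ≫ hom.app a = 𝟙 (G.obj a)

/-- A 2-functor is determined by its action on 0-cells, 1-cells and 2-cells. -/
theorem strictPseudofunctor_ext {F G : StrictPseudofunctor B C}
    (h : F.toPrelaxFunctor = G.toPrelaxFunctor) : F = G := by
  have key : ∀ (P : PrelaxFunctor B C) (F G : StrictPseudofunctor B C),
      F.toPrelaxFunctor = P → G.toPrelaxFunctor = P → F = G := by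
    rintro P ⟨⟨⟨P₁, i₁, c₁, _, _, _, _, _⟩, _, hi₁⟩, _, hc₁⟩
      ⟨⟨⟨P₂, i₂, c₂, _, _, _, _, _⟩, _, hi₂⟩, _, hc₂⟩ h₁ h₂
    dsimp only at h₁ h₂ hi₁ hi₂ hc₁ hc₂
    subst h₁
    subst h₂
    obtain rfl : i₁ = i₂ := by
      funext X
      rw [hi₁, hi₂]
    obtain rfl : @c₁ = @c₂ := by
      funext X Y Z f g
      rw [hc₁, hc₂]
    rfl
  exact key _ F G h rfl

end TwoCategories

/-- A 2-equivalence between strict 2-categories `A` and `B` over a strict 2-category `P`, with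
respect to the 2-functors `U : A ⟶ P` and `V : B ⟶ P`: mutually inverse 2-functors up to 2-natural
isomorphisms, where the 2-functors commute strictly with `U` and `V`, and the components of the
2-natural isomorphisms lie over identities of `P`. -/
structure TwoEquivalenceOver {A : Type u₁} [Bicategory.{w₁, v₁} A] [Strict A]
    {B : Type u₂} [Bicategory.{w₂, v₂} B] [Strict B]
    {P : Type u₃} [Bicategory.{w₃, v₃} P] [Strict P]
    (U : StrictPseudofunctor A P) (V : StrictPseudofunctor B P) where
  functor : StrictPseudofunctor A B
  inverse : StrictPseudofunctor B A
  functor_over : functor.comp V = U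
  inverse_over : inverse.comp U = V
  unitIso : TwoNatIso (StrictPseudofunctor.id A) (functor.comp inverse)
  counitIso : TwoNatIso (inverse.comp functor) (StrictPseudofunctor.id B)
  unit_over (a : A) : ∃ h : U.obj a = U.obj (inverse.obj (functor.obj a)),
    U.map (unitIso.hom.app a) = eqToHom h
  counit_over (b : B) : ∃ h : V.obj (functor.obj (inverse.obj b)) = V.obj b,
    V.map (counitIso.hom.app b) = eqToHom h

/-! ### Strict 2-monads, pseudo-algebras and pseudo-morphisms -/

/-- A strict 2-monad on a strict 2-category. -/
structure TwoMonad (B : Type u) [Bicategory.{w, v} B] [Strict B] where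
  T : StrictPseudofunctor B B
  η : TwoNatTrans (StrictPseudofunctor.id B) T
  μ : TwoNatTrans (T.comp T) T
  left_unit (a : B) : (η.app (T.obj a) : T.obj a ⟶ T.obj (T.obj a)) ≫ μ.app a = 𝟙 (T.obj a)
  right_unit (a : B) : T.map (η.app a) ≫ μ.app a = 𝟙 (T.obj a)
  assoc (a : B) : T.map (μ.app a) ≫ μ.app a = μ.app (T.obj a) ≫ μ.app a

namespace TwoMonad

variable {B : Type u} [Bicategory.{w, v} B] [Strict B] (M : TwoMonad B)

/-- The component `a ⟶ T a` of the unit. -/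
abbrev unit (a : B) : a ⟶ M.T.obj a := M.η.app a

/-- The component `T (T a) ⟶ T a` of the multiplication. -/
abbrev mult (a : B) : M.T.obj (M.T.obj a) ⟶ M.T.obj a := M.μ.app a

theorem unit_nat {a b : B} (f : a ⟶ b) : f ≫ M.unit b = M.unit a ≫ M.T.map f :=
  M.η.naturality f

theorem mult_nat {a b : B} (f : a ⟶ b) :
    M.T.map (M.T.map f) ≫ M.mult b = M.mult a ≫ M.T.map f :=
  M.μ.naturality f

theorem mult_unit (a : B) : M.unit (M.T.obj a) ≫ M.mult a = 𝟙 (M.T.obj a) := M.left_unit a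

theorem mult_map_unit (a : B) : M.T.map (M.unit a) ≫ M.mult a = 𝟙 (M.T.obj a) := M.right_unit a

theorem mult_mult (a : B) :
    M.T.map (M.mult a) ≫ M.mult a = M.mult (M.T.obj a) ≫ M.mult a := M.assoc a

/-- A pseudo-algebra `(A, Q, Q_μ, Q_η)` of a strict 2-monad. In the coherence conditions the
1-cells which agree strictly are identified along `eqToHom`. -/
structure PseudoAlgebra where
  carrier : B
  /-- the structure map `Q : T A ⟶ A` -/
  act : M.T.obj carrier ⟶ carrier
  /-- `Q_μ : Q ∘ T Q ⟹ Q ∘ μ_A` -/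
  actMu : M.T.map act ≫ act ≅ M.mult carrier ≫ act
  /-- `Q_η : 1 ⟹ Q ∘ η_A` -/
  actEta : 𝟙 carrier ≅ M.unit carrier ≫ act
  /-- the two ways `Q ∘ T Q ∘ T² Q ⟹ Q ∘ μ_A ∘ T μ_A = Q ∘ μ_A ∘ μ_{T A}` agree -/
  coh_assoc :
    M.T.map₂ actMu.hom ▷ act ≫
        eqToHom (by rw [M.T.map_comp, Strict.assoc]) ≫
        M.T.map (M.mult carrier) ◁ actMu.hom =
      eqToHom (by rw [M.T.map_comp, Strict.assoc]) ≫
        M.T.map (M.T.map act) ◁ actMu.hom ≫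
        eqToHom (by rw [← Strict.assoc, M.mult_nat, Strict.assoc]) ≫
        M.mult (M.T.obj carrier) ◁ actMu.hom ≫
        eqToHom (by rw [← Strict.assoc, ← M.mult_mult, Strict.assoc])
  /-- `Q ⟹ Q ∘ η_A ∘ Q = Q ∘ T Q ∘ η_{T A} ⟹ Q ∘ μ_A ∘ η_{T A} = Q` is the identity -/
  coh_unit_left :
    act ◁ actEta.hom ≫
        eqToHom (by rw [← Strict.assoc, M.unit_nat, Strict.assoc]) ≫
        M.unit (M.T.obj carrier) ◁ actMu.hom =
      eqToHom (by rw [← Strict.assoc, M.mult_unit, Strict.id_comp, Strict.comp_id])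
  /-- `Q ⟹ Q ∘ T Q ∘ T η_A ⟹ Q ∘ μ_A ∘ T η_A = Q` is the identity -/
  coh_unit_right :
    M.T.map₂ actEta.hom ▷ act ≫
        eqToHom (by rw [M.T.map_comp, Strict.assoc]) ≫
        M.T.map (M.unit carrier) ◁ actMu.hom =
      eqToHom (by rw [← Strict.assoc, M.mult_map_unit, M.T.map_id])

/-- A pseudo-morphism `(G, φ)` of pseudo-algebras. -/
structure PseudoMorphism (A A' : M.PseudoAlgebra) where
  hom : A.carrier ⟶ A'.carrier
  /-- `φ : Q' ∘ T G ⟹ G ∘ Q` -/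
  sq : M.T.map hom ≫ A'.act ≅ A.act ≫ hom
  /-- compatibility with `Q_μ` and `Q'_μ` -/
  coh_mult :
    M.T.map₂ sq.hom ▷ A'.act ≫
        eqToHom (by rw [M.T.map_comp, Strict.assoc]) ≫
        M.T.map A.act ◁ sq.hom ≫
        eqToHom (by rw [Strict.assoc]) ≫
        A.actMu.hom ▷ hom =
      eqToHom (by rw [M.T.map_comp, Strict.assoc]) ≫
        M.T.map (M.T.map hom) ◁ A'.actMu.hom ≫
        eqToHom (by rw [← Strict.assoc, M.mult_nat, Strict.assoc]) ≫
        M.mult A.carrier ◁ sq.hom ≫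
        eqToHom (by rw [Strict.assoc])
  /-- compatibility with `Q_η` and `Q'_η` -/
  coh_unit :
    hom ◁ A'.actEta.hom ≫
        eqToHom (by rw [← Strict.assoc, M.unit_nat, Strict.assoc]) ≫
        M.unit A.carrier ◁ sq.hom =
      eqToHom (by rw [Strict.comp_id, Strict.id_comp]) ≫
        A.actEta.hom ▷ hom ≫ eqToHom (by rw [Strict.assoc])


attribute [local simp] Strict.leftUnitor_eqToIso Strict.rightUnitor_eqToIso
  Strict.associator_eqToIso PrelaxFunctor.map₂_eqToHom StrictPseudofunctor.mapComp_eq_eqToIso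

theorem whiskerLeft_congr {a b c : B} {f f' : a ⟶ b} (h : f = f') {g g' : b ⟶ c} (θ : g ⟶ g') :
    f ◁ θ = eqToHom (by rw [h]) ≫ f' ◁ θ ≫ eqToHom (by rw [h]) := by
  subst h; simp

theorem whiskerRight_congr {a b c : B} {g g' : b ⟶ c} (h : g = g') {f f' : a ⟶ b} (θ : f ⟶ f') :
    θ ▷ g = eqToHom (by rw [h]) ≫ θ ▷ g' ≫ eqToHom (by rw [h]) := by
  subst h; simp

namespace PseudoMorphism

variable {M}

/-- The structure 2-cell of an identity pseudo-morphism: `Q ∘ T 1 = 1 ∘ Q`. -/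
def idSq {A : B} (a : M.T.obj A ⟶ A) : M.T.map (𝟙 A) ≫ a ≅ a ≫ 𝟙 A :=
  eqToIso (by rw [M.T.map_id, Strict.id_comp, Strict.comp_id])

/-- The structure 2-cell of a composite pseudo-morphism, pasted from `φ` and `ψ`. -/
def compSq {A A' A'' : B} {a : M.T.obj A ⟶ A} {a' : M.T.obj A' ⟶ A'} {a'' : M.T.obj A'' ⟶ A''}
    {f : A ⟶ A'} {g : A' ⟶ A''} (φ : M.T.map f ≫ a' ≅ a ≫ f) (ψ : M.T.map g ≫ a'' ≅ a' ≫ g) :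
    M.T.map (f ≫ g) ≫ a'' ≅ a ≫ f ≫ g :=
  eqToIso (by rw [M.T.map_comp, Strict.assoc]) ≪≫ whiskerLeftIso (M.T.map f) ψ ≪≫
    eqToIso (by rw [Strict.assoc]) ≪≫ whiskerRightIso φ g ≪≫ eqToIso (by rw [Strict.assoc])

theorem idSq_compSq {A A' : B} {a : M.T.obj A ⟶ A} {a' : M.T.obj A' ⟶ A'}
    {f : A ⟶ A'} (φ : M.T.map f ≫ a' ≅ a ≫ f) :
    (compSq (idSq a) φ).hom ≫ eqToHom (by rw [Strict.id_comp]) =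
      eqToHom (by rw [Strict.id_comp]) ≫ φ.hom := by
  have := whiskerLeft_congr (M.T.map_id A) φ.hom
  simp at this
  simp [this, compSq, idSq]

theorem compSq_idSq {A A' : B} {a : M.T.obj A ⟶ A} {a' : M.T.obj A' ⟶ A'}
    {f : A ⟶ A'} (φ : M.T.map f ≫ a' ≅ a ≫ f) :
    (compSq φ (idSq a')).hom ≫ eqToHom (by rw [Strict.comp_id]) =
      eqToHom (by rw [Strict.comp_id]) ≫ φ.hom := by
  simp [compSq, idSq]

theorem compSq_assoc {A₁ A₂ A₃ A₄ : B} {a₁ : M.T.obj A₁ ⟶ A₁} {a₂ : M.T.obj A₂ ⟶ A₂}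
    {a₃ : M.T.obj A₃ ⟶ A₃} {a₄ : M.T.obj A₄ ⟶ A₄} {f : A₁ ⟶ A₂} {g : A₂ ⟶ A₃} {h : A₃ ⟶ A₄}
    (φ : M.T.map f ≫ a₂ ≅ a₁ ≫ f) (ψ : M.T.map g ≫ a₃ ≅ a₂ ≫ g) (χ : M.T.map h ≫ a₄ ≅ a₃ ≫ h) :
    (compSq (compSq φ ψ) χ).hom ≫ eqToHom (by rw [Strict.assoc]) =
      eqToHom (by rw [Strict.assoc]) ≫ (compSq φ (compSq ψ χ)).hom := by
  have := whiskerLeft_congr (M.T.map_comp f g) χ.hom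
  simp at this
  simp [this, compSq]

/-- The identity pseudo-morphism. -/
def id (A : M.PseudoAlgebra) : PseudoMorphism M A A where
  hom := 𝟙 A.carrier
  sq := idSq A.act
  coh_mult := by
    rw [whiskerLeft_congr (show M.T.map (M.T.map (𝟙 A.carrier)) = 𝟙 _ by simp [M.T.map_id])]
    simp [idSq]
  coh_unit := by
    simp [idSq]

/-- Composition of pseudo-morphisms. -/
def comp {A A' A'' : M.PseudoAlgebra} (f : PseudoMorphism M A A') (g : PseudoMorphism M A' A'') :
    PseudoMorphism M A A'' where
  hom := f.hom ≫ g.hom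
  sq := compSq f.sq g.sq
  coh_mult := by
    have hf := congr($(f.coh_mult) ▷ g.hom)
    have hg := congr(M.T.map (M.T.map f.hom) ◁ $(g.coh_mult))
    have he := (whisker_exchange (M.T.map₂ f.sq.hom) g.sq.hom).symm
    have hm := whiskerLeft_congr (M.mult_nat f.hom) g.sq.hom
    have hc := whiskerLeft_congr (show M.T.map (M.T.map (f.hom ≫ g.hom)) = _ by
      rw [M.T.map_comp, M.T.map_comp]) A''.actMu.hom
    rw [whiskerLeft_congr (M.T.map_comp _ _) g.sq.hom,
      whiskerLeft_congr (M.T.map_comp _ _) g.sq.hom] at he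
    simp [compSq] at hf hg he hm hc ⊢
    simp only [← Category.assoc, comp_eqToHom_iff] at he hm
    simp only [Category.assoc, eqToHom_comp_iff, eqToHom_trans, eqToHom_trans_assoc] at he hm
    rw [reassoc_of% he]
    simp only [eqToHom_trans_assoc]
    rw [reassoc_of% hf]
    simp only [eqToHom_trans_assoc]
    rw [reassoc_of% hg, hc, hm]
    simp
  coh_unit := by
    have hf := congr($(f.coh_unit) ▷ g.hom)
    have hg := congr(f.hom ◁ $(g.coh_unit))
    have hm := whiskerLeft_congr (M.unit_nat f.hom) g.sq.hom
    simp [compSq] at hf hg hm ⊢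
    simp only [← Category.assoc, comp_eqToHom_iff] at hf hm
    simp only [Category.assoc, eqToHom_comp_iff, eqToHom_trans, eqToHom_trans_assoc] at hf hm
    rw [hm] at hg
    simp only [← Category.assoc, comp_eqToHom_iff] at hg
    simp only [Category.assoc, eqToHom_trans] at hg
    rw [reassoc_of% hg]
    simp only [eqToHom_trans_assoc]
    rw [reassoc_of% hf]
    simp

/-- Two parallel pseudo-morphisms agree as soon as their 1-cells and 2-cells do. -/
theorem ext' {A A' : M.PseudoAlgebra} {f g : PseudoMorphism M A A'} (h : f.hom = g.hom)
    (h₂ : f.sq.hom ≫ eqToHom (by rw [h]) = eqToHom (by rw [h]) ≫ g.sq.hom) : f = g := by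
  obtain ⟨f, φ, _, _⟩ := f
  obtain ⟨g, ψ, _, _⟩ := g
  dsimp only at h
  subst h
  obtain rfl : φ = ψ := by
    ext
    simpa using h₂
  rfl

protected theorem id_comp {A A' : M.PseudoAlgebra} (f : PseudoMorphism M A A') :
    comp (id A) f = f :=
  ext' (Strict.id_comp f.hom) (idSq_compSq f.sq)

protected theorem comp_id {A A' : M.PseudoAlgebra} (f : PseudoMorphism M A A') :
    comp f (id A') = f :=
  ext' (Strict.comp_id f.hom) (compSq_idSq f.sq)

protected theorem assoc {A₁ A₂ A₃ A₄ : M.PseudoAlgebra} (f : PseudoMorphism M A₁ A₂)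
    (g : PseudoMorphism M A₂ A₃) (h : PseudoMorphism M A₃ A₄) :
    comp (comp f g) h = comp f (comp g h) :=
  ext' (Strict.assoc f.hom g.hom h.hom) (compSq_assoc f.sq g.sq h.sq)

/-- A 2-cell of pseudo-morphisms: a 2-cell compatible with the structure 2-cells. -/
@[ext]
structure Hom₂ {A A' : M.PseudoAlgebra} (f g : PseudoMorphism M A A') where
  cell : f.hom ⟶ g.hom
  coh : M.T.map₂ cell ▷ A'.act ≫ g.sq.hom = f.sq.hom ≫ A.act ◁ cell

instance (A A' : M.PseudoAlgebra) : Category (PseudoMorphism M A A') where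
  Hom f g := Hom₂ f g
  id f := { cell := 𝟙 f.hom, coh := by simp }
  comp α β :=
    { cell := α.cell ≫ β.cell
      coh := by simp [β.coh, reassoc_of% α.coh] }

@[ext]
theorem hom₂_ext {A A' : M.PseudoAlgebra} {f g : PseudoMorphism M A A'} {α β : f ⟶ g}
    (h : α.cell = β.cell) : α = β := Hom₂.ext h

@[simp] theorem id_cell {A A' : M.PseudoAlgebra} (f : PseudoMorphism M A A') :
    Hom₂.cell (𝟙 f) = 𝟙 f.hom := rfl

@[simp] theorem comp_cell {A A' : M.PseudoAlgebra} {f g h : PseudoMorphism M A A'}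
    (α : f ⟶ g) (β : g ⟶ h) : (α ≫ β).cell = α.cell ≫ β.cell := rfl

@[simp] theorem eqToHom_cell {A A' : M.PseudoAlgebra} {f g : PseudoMorphism M A A'} (h : f = g) :
    (eqToHom h).cell = eqToHom (by rw [h]) := by
  subst h; rfl

/-- Left whiskering of a 2-cell by a pseudo-morphism. -/
def wLeft {A A' A'' : M.PseudoAlgebra} (f : PseudoMorphism M A A')
    {g h : PseudoMorphism M A' A''} (α : g ⟶ h) : comp f g ⟶ comp f h where
  cell := f.hom ◁ α.cell
  coh := by
    have h₁ := congr(M.T.map f.hom ◁ $(α.coh))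
    have h₂ := whisker_exchange f.sq.hom α.cell
    simp at h₁ h₂
    simp only [eqToHom_comp_iff] at h₂
    simp [comp, compSq, reassoc_of% h₁, reassoc_of% h₂]

/-- Right whiskering of a 2-cell by a pseudo-morphism. -/
def wRight {A A' A'' : M.PseudoAlgebra} {f g : PseudoMorphism M A A'} (α : f ⟶ g)
    (h : PseudoMorphism M A' A'') : comp f h ⟶ comp g h where
  cell := α.cell ▷ h.hom
  coh := by
    have h₁ := congr($(α.coh) ▷ h.hom)
    have h₂ := (whisker_exchange (M.T.map₂ α.cell) h.sq.hom).symm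
    simp at h₁ h₂
    simp only [eqToHom_comp_iff] at h₂
    simp [comp, compSq, reassoc_of% h₁, reassoc_of% h₂]

section

variable {A₁ A₂ A₃ A₄ A₅ : M.PseudoAlgebra}

theorem wLeft_comp (f : PseudoMorphism M A₁ A₂) {g h i : PseudoMorphism M A₂ A₃}
    (α : g ⟶ h) (β : h ⟶ i) : wLeft f (α ≫ β) = wLeft f α ≫ wLeft f β :=
  Hom₂.ext (whiskerLeft_comp f.hom α.cell β.cell)

theorem comp_wRight {f g h : PseudoMorphism M A₁ A₂} (α : f ⟶ g) (β : g ⟶ h)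
    (i : PseudoMorphism M A₂ A₃) : wRight (α ≫ β) i = wRight α i ≫ wRight β i :=
  Hom₂.ext (comp_whiskerRight α.cell β.cell i.hom)

theorem id_wLeft {f g : PseudoMorphism M A₁ A₂} (α : f ⟶ g) :
    wLeft (id A₁) α = eqToHom (PseudoMorphism.id_comp f) ≫ α ≫
      eqToHom (PseudoMorphism.id_comp g).symm := by
  ext; rw [comp_cell, comp_cell, eqToHom_cell, eqToHom_cell]; dsimp only [wLeft, id, comp]; simp

theorem comp_wLeft (f : PseudoMorphism M A₁ A₂) (g : PseudoMorphism M A₂ A₃)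
    {h i : PseudoMorphism M A₃ A₄} (α : h ⟶ i) :
    wLeft (comp f g) α = eqToHom (PseudoMorphism.assoc f g h) ≫ wLeft f (wLeft g α) ≫
      eqToHom (PseudoMorphism.assoc f g i).symm := by
  ext; rw [comp_cell, comp_cell, eqToHom_cell, eqToHom_cell]; dsimp only [wLeft, comp]; simp

theorem wRight_id {f g : PseudoMorphism M A₁ A₂} (α : f ⟶ g) :
    wRight α (id A₂) = eqToHom (PseudoMorphism.comp_id f) ≫ α ≫
      eqToHom (PseudoMorphism.comp_id g).symm := by
  ext; rw [comp_cell, comp_cell, eqToHom_cell, eqToHom_cell]; dsimp only [wRight, id, comp]; simp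

theorem wRight_comp {f g : PseudoMorphism M A₁ A₂} (α : f ⟶ g) (h : PseudoMorphism M A₂ A₃)
    (i : PseudoMorphism M A₃ A₄) :
    wRight α (comp h i) = eqToHom (PseudoMorphism.assoc f h i).symm ≫ wRight (wRight α h) i ≫
      eqToHom (PseudoMorphism.assoc g h i) := by
  ext; rw [comp_cell, comp_cell, eqToHom_cell, eqToHom_cell]; dsimp only [wRight, comp]; simp

theorem wLeft_wRight (f : PseudoMorphism M A₁ A₂) {g h : PseudoMorphism M A₂ A₃} (α : g ⟶ h)
    (i : PseudoMorphism M A₃ A₄) :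
    wRight (wLeft f α) i = eqToHom (PseudoMorphism.assoc f g i) ≫ wLeft f (wRight α i) ≫
      eqToHom (PseudoMorphism.assoc f h i).symm := by
  ext; rw [comp_cell, comp_cell, eqToHom_cell, eqToHom_cell]; dsimp only [wLeft, wRight, comp]; simp

theorem whisker_exch {f g : PseudoMorphism M A₁ A₂} {h i : PseudoMorphism M A₂ A₃}
    (α : f ⟶ g) (β : h ⟶ i) : wLeft f β ≫ wRight α i = wRight α h ≫ wLeft g β :=
  Hom₂.ext (whisker_exchange α.cell β.cell)

theorem wLeft_eqToHom (f : PseudoMorphism M A₁ A₂) {g h : PseudoMorphism M A₂ A₃} (e : g = h) :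
    wLeft f (eqToHom e) = eqToHom (by rw [e]) := by
  subst e; exact Hom₂.ext (whiskerLeft_id f.hom g.hom)

theorem eqToHom_wRight {f g : PseudoMorphism M A₁ A₂} (e : f = g) (h : PseudoMorphism M A₂ A₃) :
    wRight (eqToHom e) h = eqToHom (by rw [e]) := by
  subst e; exact Hom₂.ext (id_whiskerRight f.hom h.hom)

end

end PseudoMorphism

/-- The strict 2-category of pseudo-algebras, pseudo-morphisms and 2-cells between them. -/
instance : Bicategory M.PseudoAlgebra where
  Hom A A' := PseudoMorphism M A A'
  id A := PseudoMorphism.id A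
  comp f g := PseudoMorphism.comp f g
  whiskerLeft f _ _ α := PseudoMorphism.wLeft f α
  whiskerRight α h := PseudoMorphism.wRight α h
  associator f g h := eqToIso (PseudoMorphism.assoc f g h)
  leftUnitor f := eqToIso (PseudoMorphism.id_comp f)
  rightUnitor f := eqToIso (PseudoMorphism.comp_id f)
  whiskerLeft_id f g := PseudoMorphism.Hom₂.ext (whiskerLeft_id f.hom g.hom)
  whiskerLeft_comp f _ _ _ α β := PseudoMorphism.wLeft_comp f α β
  id_whiskerLeft α := PseudoMorphism.id_wLeft α
  comp_whiskerLeft f g _ _ α := PseudoMorphism.comp_wLeft f g α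
  id_whiskerRight f g := PseudoMorphism.Hom₂.ext (id_whiskerRight f.hom g.hom)
  comp_whiskerRight α β i := PseudoMorphism.comp_wRight α β i
  whiskerRight_id α := PseudoMorphism.wRight_id α
  whiskerRight_comp α g h := PseudoMorphism.wRight_comp α g h
  whisker_assoc f _ _ α h := PseudoMorphism.wLeft_wRight f α h
  whisker_exchange α β := PseudoMorphism.whisker_exch α β
  pentagon f g h i := by
    simp [PseudoMorphism.wLeft_eqToHom, PseudoMorphism.eqToHom_wRight]
  triangle f g := by
    simp [PseudoMorphism.wLeft_eqToHom, PseudoMorphism.eqToHom_wRight]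

instance : Strict M.PseudoAlgebra where
  id_comp f := PseudoMorphism.id_comp f
  comp_id f := PseudoMorphism.comp_id f
  assoc f g h := PseudoMorphism.assoc f g h
  leftUnitor_eqToIso _ := rfl
  rightUnitor_eqToIso _ := rfl
  associator_eqToIso _ _ _ := rfl

/-- The forgetful 2-functor from pseudo-algebras to the base 2-category. -/
def forget : StrictPseudofunctor M.PseudoAlgebra B :=
  StrictPseudofunctor.mk'' {
    obj A := A.carrier
    map {A A'} f := PseudoMorphism.hom (A := A) (A' := A') f
    map₂ {A A' f g} α := PseudoMorphism.Hom₂.cell (A := A) (A' := A') (f := f) (g := g) α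
    map_id _ := rfl
    map_comp _ _ := rfl
    map₂_id _ := rfl
    map₂_comp _ _ := rfl
    map₂_whisker_left _ _ _ _ :=
      ((Category.id_comp _).trans (Category.comp_id _)).symm
    map₂_whisker_right _ _ :=
      ((Category.id_comp _).trans (Category.comp_id _)).symm }

end TwoMonad

/-! ### Pointed categories and the 2-monad `C ↦ C × C` -/

/-- A pointed category: a category which has a zero object. -/
structure PointCat : Type (max (u + 1) (v + 1)) where
  carrier : Type u
  [cat : Category.{v} carrier]
  [hasZero : HasZeroObject carrier]

attribute [instance] PointCat.cat PointCat.hasZero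

/-- The functors which send zero objects to zero objects. -/
def PreservesZeroObjects (C : Type u₁) [Category.{v₁} C] (D : Type u₂) [Category.{v₂} D] :
    ObjectProperty (C ⥤ D) :=
  fun F => ∀ X : C, IsZero X → IsZero (F.obj X)

namespace PointCat

/-- The strict 2-category of pointed categories, functors preserving zero objects, and all natural
transformations. -/
instance : Bicategory PointCat.{v, u} where
  Hom C D := (PreservesZeroObjects C.carrier D.carrier).FullSubcategory
  homCategory _ _ := ObjectProperty.FullSubcategory.category _
  id C := ⟨𝟭 C.carrier, fun _ h => h⟩
  comp F G := ⟨F.obj ⋙ G.obj, fun X h => G.property _ (F.property X h)⟩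
  whiskerLeft F _ _ α := ObjectProperty.homMk (Functor.whiskerLeft F.obj α.hom)
  whiskerRight α G := ObjectProperty.homMk (Functor.whiskerRight α.hom G.obj)
  associator F G H := ObjectProperty.isoMk _ (Functor.associator F.obj G.obj H.obj)
  leftUnitor F := ObjectProperty.isoMk _ F.obj.leftUnitor
  rightUnitor F := ObjectProperty.isoMk _ F.obj.rightUnitor

instance : Strict PointCat.{v, u} where
  id_comp _ := rfl
  comp_id _ := rfl
  assoc _ _ _ := rfl
  leftUnitor_eqToIso _ := rfl
  rightUnitor_eqToIso _ := rfl
  associator_eqToIso _ _ _ := rfl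

end PointCat

section Products

variable {C : Type u₁} [Category.{v₁} C] {D : Type u₂} [Category.{v₂} D]

theorem isZero_prod {X : C} {Y : D} (hX : IsZero X) (hY : IsZero Y) : IsZero (X, Y) where
  unique_to Z := ⟨⟨⟨(hX.to_ Z.1, hY.to_ Z.2)⟩, fun _ =>
    Prod.ext (hX.eq_of_src _ _) (hY.eq_of_src _ _)⟩⟩
  unique_from Z := ⟨⟨⟨(hX.from_ Z.1, hY.from_ Z.2)⟩, fun _ =>
    Prod.ext (hX.eq_of_tgt _ _) (hY.eq_of_tgt _ _)⟩⟩

instance [HasZeroObject C] [HasZeroObject D] : HasZeroObject (C × D) := by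
  obtain ⟨X, hX⟩ := HasZeroObject.zero (C := C)
  obtain ⟨Y, hY⟩ := HasZeroObject.zero (C := D)
  exact ⟨(X, Y), isZero_prod hX hY⟩

theorem isZero_prod_iff [HasZeroObject C] [HasZeroObject D] (X : C × D) :
    IsZero X ↔ IsZero X.1 ∧ IsZero X.2 := by
  refine ⟨fun h => ?_, fun h => isZero_prod h.1 h.2⟩
  obtain ⟨Y, hY⟩ := HasZeroObject.zero (C := C)
  obtain ⟨Z, hZ⟩ := HasZeroObject.zero (C := D)
  have e : X ≅ (Y, Z) := h.iso (isZero_prod hY hZ)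
  exact ⟨hY.of_iso ((CategoryTheory.Prod.fst C D).mapIso e), hZ.of_iso ((CategoryTheory.Prod.snd C D).mapIso e)⟩

end Products

namespace PointCat

/-- The 2-functor `C ↦ C × C`, `G ↦ G × G`, `α ↦ α × α`. -/
def square : StrictPseudofunctor PointCat.{v, u} PointCat.{v, u} :=
  StrictPseudofunctor.mk'' {
    obj C := ⟨C.carrier × C.carrier⟩
    map F := ⟨F.obj.prod F.obj, fun X h => by
      rw [isZero_prod_iff] at h
      exact isZero_prod (F.property _ h.1) (F.property _ h.2)⟩
    map₂ α := ObjectProperty.homMk (NatTrans.prod α.hom α.hom)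
    map_id _ := rfl
    map_comp _ _ := rfl
    map₂_id _ := rfl
    map₂_comp _ _ := rfl
    map₂_whisker_left _ _ _ _ := ((Category.id_comp _).trans (Category.comp_id _)).symm
    map₂_whisker_right _ _ := ((Category.id_comp _).trans (Category.comp_id _)).symm }

/-- The strict 2-monad `M* C = C × C` on pointed categories: the unit is the diagonal functor, and
the multiplication is the projection `(C × C) × (C × C) ⥤ C × C` on the first and fourth
components. -/
def squareMonad : TwoMonad PointCat.{v, u} where
  T := square
  η :=
    { app C := ⟨Functor.diag C.carrier, fun _ h => isZero_prod h h⟩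
      naturality _ := rfl
      naturality₂ _ := (Category.comp_id _).trans (Category.id_comp _).symm }
  μ :=
    { app C := ⟨(CategoryTheory.Prod.fst C.carrier C.carrier).prod
          (CategoryTheory.Prod.snd C.carrier C.carrier), fun X h => by
        have h₁ := (isZero_prod_iff X).1 h
        exact isZero_prod ((isZero_prod_iff X.1).1 h₁.1).1 ((isZero_prod_iff X.2).1 h₁.2).2⟩
      naturality _ := rfl
      naturality₂ _ := (Category.comp_id _).trans (Category.id_comp _).symm }
  left_unit _ := rfl
  right_unit _ := rfl
  assoc _ := rfl

end PointCat

/-! ### Pretorsion theories and rectangular torsion theories -/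

section Pretorsion

variable {C : Type u} [Category.{v} C]

/-- The ideal of the morphisms which factor through an object satisfying `Z`. -/
def factorsThrough (Z : ObjectProperty C) : MorphismProperty C :=
  fun X Y f => ∃ (W : C) (_ : Z W) (g : X ⟶ W) (h : W ⟶ Y), g ≫ h = f

/-- `k` is a kernel of `f` relative to the ideal `N`. -/
def IsKernel (N : MorphismProperty C) {K X Y : C} (k : K ⟶ X) (f : X ⟶ Y) : Prop :=
  N (k ≫ f) ∧ ∀ ⦃W : C⦄ (g : W ⟶ X), N (g ≫ f) → ∃! g' : W ⟶ K, g' ≫ k = g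

/-- `c` is a cokernel of `f` relative to the ideal `N`. -/
def IsCokernel (N : MorphismProperty C) {X Y Q : C} (c : Y ⟶ Q) (f : X ⟶ Y) : Prop :=
  N (f ≫ c) ∧ ∀ ⦃W : C⦄ (g : Y ⟶ W), N (f ≫ g) → ∃! g' : Q ⟶ W, c ≫ g' = g

/-- `A ⟶ X ⟶ B` is a short exact sequence relative to the ideal `N`. -/
structure IsShortExact (N : MorphismProperty C) {A X B : C} (l : A ⟶ X) (r : X ⟶ B) : Prop where
  isKernel : IsKernel N l r
  isCokernel : IsCokernel N r l

end Pretorsion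

/-- A pretorsion theory `(C, 𝒯, ℱ)`, equipped with a choice of a short exact sequence
`T X ⟶ X ⟶ F X` for every object `X`. The choice is normalized: it is
`X = X ⟶ F X` for torsion `X`, and `T X ⟶ X = X` for torsion-free `X`. -/
structure PretorsionTheory (C : Type u) [Category.{v} C] where
  /-- the objects of the full subcategory `𝒯` -/
  tors : ObjectProperty C
  /-- the objects of the full subcategory `ℱ` -/
  free : ObjectProperty C
  tors_replete : tors.IsClosedUnderIsomorphisms
  free_replete : free.IsClosedUnderIsomorphisms
  null_of_tors_of_free {X Y : C} (f : X ⟶ Y) : tors X → free Y → factorsThrough (tors ⊓ free) f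
  T : C → C
  F : C → C
  tors_T (X : C) : tors (T X)
  free_F (X : C) : free (F X)
  l (X : C) : T X ⟶ X
  r (X : C) : X ⟶ F X
  exact (X : C) : IsShortExact (factorsThrough (tors ⊓ free)) (l X) (r X)
  l_of_tors (X : C) : tors X → ∃ h : T X = X, l X = eqToHom h
  r_of_free (X : C) : free X → ∃ h : X = F X, r X = eqToHom h

namespace PretorsionTheory

variable {C : Type u₁} [Category.{v₁} C] {D : Type u₂} [Category.{v₂} D]
  {E : Type u₃} [Category.{v₃} E]

/-- The ideal of null morphisms: those which factor through an object of `𝒯 ∩ ℱ`. -/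
abbrev null (P : PretorsionTheory C) : MorphismProperty C := factorsThrough (P.tors ⊓ P.free)

variable (P : PretorsionTheory C)

theorem null_comp_left {X Y Z : C} {f : Y ⟶ Z} (h : P.null f) (g : X ⟶ Y) : P.null (g ≫ f) := by
  obtain ⟨W, hW, a, b, rfl⟩ := h
  exact ⟨W, hW, g ≫ a, b, by simp⟩

theorem null_comp_right {X Y Z : C} {f : X ⟶ Y} (h : P.null f) (g : Y ⟶ Z) :
    P.null (f ≫ g) := by
  obtain ⟨W, hW, a, b, rfl⟩ := h
  exact ⟨W, hW, a, b ≫ g, by simp⟩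

theorem existsUnique_mapT {X Y : C} (h : X ⟶ Y) :
    ∃! h' : P.T X ⟶ P.T Y, h' ≫ P.l Y = P.l X ≫ h :=
  (P.exact Y).isKernel.2 _ (P.null_of_tors_of_free _ (P.tors_T X) (P.free_F Y))

theorem existsUnique_mapF {X Y : C} (h : X ⟶ Y) :
    ∃! h' : P.F X ⟶ P.F Y, P.r X ≫ h' = h ≫ P.r Y :=
  (P.exact X).isCokernel.2 _ (P.null_of_tors_of_free _ (P.tors_T X) (P.free_F Y))

/-- The unique `T X ⟶ T Y` compatible with `h : X ⟶ Y`. -/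
noncomputable def mapT {X Y : C} (h : X ⟶ Y) : P.T X ⟶ P.T Y := (P.existsUnique_mapT h).choose

/-- The unique `F X ⟶ F Y` compatible with `h : X ⟶ Y`. -/
noncomputable def mapF {X Y : C} (h : X ⟶ Y) : P.F X ⟶ P.F Y := (P.existsUnique_mapF h).choose

theorem mapT_l {X Y : C} (h : X ⟶ Y) : P.mapT h ≫ P.l Y = P.l X ≫ h :=
  (P.existsUnique_mapT h).choose_spec.1

theorem r_mapF {X Y : C} (h : X ⟶ Y) : P.r X ≫ P.mapF h = h ≫ P.r Y :=
  (P.existsUnique_mapF h).choose_spec.1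

theorem eq_mapT {X Y : C} {h : X ⟶ Y} {h' : P.T X ⟶ P.T Y} (e : h' ≫ P.l Y = P.l X ≫ h) :
    h' = P.mapT h :=
  (P.existsUnique_mapT h).choose_spec.2 _ e

theorem eq_mapF {X Y : C} {h : X ⟶ Y} {h' : P.F X ⟶ P.F Y} (e : P.r X ≫ h' = h ≫ P.r Y) :
    h' = P.mapF h :=
  (P.existsUnique_mapF h).choose_spec.2 _ e

/-- The torsion part, as a functor `C ⥤ 𝒯`. -/
noncomputable def torsionFunctor : C ⥤ P.tors.FullSubcategory where
  obj X := ⟨P.T X, P.tors_T X⟩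
  map h := ObjectProperty.homMk (P.mapT h)
  map_id X := ObjectProperty.hom_ext _ (P.eq_mapT (by simp)).symm
  map_comp f g := ObjectProperty.hom_ext _ (P.eq_mapT (by
    simp [mapT_l, reassoc_of% (P.mapT_l f)])).symm

/-- The torsion-free part, as a functor `C ⥤ ℱ`. -/
noncomputable def torsionFreeFunctor : C ⥤ P.free.FullSubcategory where
  obj X := ⟨P.F X, P.free_F X⟩
  map h := ObjectProperty.homMk (P.mapF h)
  map_id X := ObjectProperty.hom_ext _ (P.eq_mapF (by simp)).symm
  map_comp f g := ObjectProperty.hom_ext _ (P.eq_mapF (by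
    simp [r_mapF, reassoc_of% (P.r_mapF f)])).symm

/-- The canonical functor `Γ : C ⥤ 𝒯 × ℱ`. -/
noncomputable def Γ : C ⥤ P.tors.FullSubcategory × P.free.FullSubcategory :=
  P.torsionFunctor.prod' P.torsionFreeFunctor

/-- A pretorsion theory is rectangular if `Γ` is an equivalence of categories. -/
def IsRectangular : Prop := P.Γ.IsEquivalence

variable {P}

/-- Short exact sequences are stable under isomorphism of the outer terms. -/
theorem isShortExact_of_iso {A A' X B B' : C} {l : A ⟶ X} {r : X ⟶ B}
    (h : IsShortExact P.null l r) (a : A' ≅ A) (b : B ≅ B') :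
    IsShortExact P.null (a.hom ≫ l) (r ≫ b.hom) where
  isKernel := by
    refine ⟨?_, fun W g hg => ?_⟩
    · simpa using P.null_comp_left (P.null_comp_right h.isKernel.1 b.hom) a.hom
    · obtain ⟨w, hw, hu⟩ := h.isKernel.2 g (by simpa using P.null_comp_right hg b.inv)
      refine ⟨w ≫ a.inv, by simpa using hw, fun y hy => ?_⟩
      rw [← hu (y ≫ a.hom) (by simpa using hy)]
      simp
  isCokernel := by
    refine ⟨?_, fun W g hg => ?_⟩
    · simpa using P.null_comp_left (P.null_comp_right h.isKernel.1 b.hom) a.hom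
    · obtain ⟨w, hw, hu⟩ := h.isCokernel.2 g (by simpa using P.null_comp_left hg a.inv)
      refine ⟨b.inv ≫ w, by simpa using hw, fun y hy => ?_⟩
      rw [← hu (b.hom ≫ y) (by simpa using hy)]
      simp

/-- A short exact sequence from a torsion object to a torsion-free object is isomorphic to the
chosen one. -/
theorem exists_iso {A X B : C} {l : A ⟶ X} {r : X ⟶ B} (hA : P.tors A) (hB : P.free B)
    (h : IsShortExact P.null l r) :
    ∃ (a : A ≅ P.T X) (b : P.F X ≅ B), a.hom ≫ P.l X = l ∧ P.r X ≫ b.hom = r := by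
  obtain ⟨a, ha, -⟩ := (P.exact X).isKernel.2 l (P.null_of_tors_of_free _ hA (P.free_F X))
  obtain ⟨a', ha', -⟩ := h.isKernel.2 (P.l X) (P.null_of_tors_of_free _ (P.tors_T X) hB)
  obtain ⟨b, hb, -⟩ := (P.exact X).isCokernel.2 r (P.null_of_tors_of_free _ (P.tors_T X) hB)
  obtain ⟨b', hb', -⟩ := h.isCokernel.2 (P.r X) (P.null_of_tors_of_free _ hA (P.free_F X))
  refine ⟨⟨a, a', ?_, ?_⟩, ⟨b, b', ?_, ?_⟩, ha, hb⟩
  · exact (h.isKernel.2 l h.isKernel.1).unique (by simp [ha, ha']) (by simp)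
  · exact ((P.exact X).isKernel.2 _ (P.exact X).isKernel.1).unique (by simp [ha, ha']) (by simp)
  · exact ((P.exact X).isCokernel.2 _ (P.exact X).isCokernel.1).unique
      (by simp [reassoc_of% hb, hb']) (by simp)
  · exact (h.isCokernel.2 r h.isCokernel.1).unique (by simp [reassoc_of% hb', hb]) (by simp)

variable (P) (Q : PretorsionTheory D) (R : PretorsionTheory E)

/-- A functor is a morphism of pretorsion theories if it preserves torsion objects and torsion-free
objects, and sends the chosen short exact sequences to short exact sequences. -/
structure IsMorphism (G : C ⥤ D) : Prop where
  map_tors (X : C) : P.tors X → Q.tors (G.obj X)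
  map_free (X : C) : P.free X → Q.free (G.obj X)
  map_exact (X : C) : IsShortExact Q.null (G.map (P.l X)) (G.map (P.r X))

theorem isMorphism_id : IsMorphism P P (𝟭 C) where
  map_tors _ h := h
  map_free _ h := h
  map_exact X := P.exact X

variable {P Q R}

theorem IsMorphism.comp {G : C ⥤ D} {H : D ⥤ E} (hG : IsMorphism P Q G) (hH : IsMorphism Q R H) :
    IsMorphism P R (G ⋙ H) where
  map_tors X h := hH.map_tors _ (hG.map_tors X h)
  map_free X h := hH.map_free _ (hG.map_free X h)
  map_exact X := by
    obtain ⟨a, b, ha, hb⟩ := exists_iso (hG.map_tors _ (P.tors_T X)) (hG.map_free _ (P.free_F X))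
      (hG.map_exact X)
    have := isShortExact_of_iso (hH.map_exact (G.obj X)) (H.mapIso a) (H.mapIso b)
    rw [Functor.mapIso_hom, Functor.mapIso_hom, ← H.map_comp, ← H.map_comp, ha, hb] at this
    exact this

end PretorsionTheory

/-- A rectangular torsion theory: a rectangular pretorsion theory on a pointed category, such that
the objects of `𝒯 ∩ ℱ` are the zero objects. -/
structure TorR : Type (max (u + 1) (v + 1)) where
  base : PointCat.{v, u}
  theory : PretorsionTheory base.carrier
  isRectangular : theory.IsRectangular
  tors_and_free_iff (X : base.carrier) : theory.tors X ∧ theory.free X ↔ IsZero X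

namespace TorR

/-- The functors underlying the 1-cells of `TorR`. -/
def IsMorphism (P Q : TorR.{v, u}) : ObjectProperty (P.base.carrier ⥤ Q.base.carrier) :=
  fun G => PretorsionTheory.IsMorphism P.theory Q.theory G

/-- The strict 2-category of rectangular torsion theories, morphisms of pretorsion theories, and all
natural transformations. -/
instance : Bicategory TorR.{v, u} where
  Hom P Q := (IsMorphism P Q).FullSubcategory
  homCategory _ _ := ObjectProperty.FullSubcategory.category _
  id P := ⟨𝟭 P.base.carrier, P.theory.isMorphism_id⟩
  comp F G := ⟨F.obj ⋙ G.obj, PretorsionTheory.IsMorphism.comp F.property G.property⟩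
  whiskerLeft F _ _ α := ObjectProperty.homMk (Functor.whiskerLeft F.obj α.hom)
  whiskerRight α G := ObjectProperty.homMk (Functor.whiskerRight α.hom G.obj)
  associator F G H := ObjectProperty.isoMk _ (Functor.associator F.obj G.obj H.obj)
  leftUnitor F := ObjectProperty.isoMk _ F.obj.leftUnitor
  rightUnitor F := ObjectProperty.isoMk _ F.obj.rightUnitor

instance : Strict TorR.{v, u} where
  id_comp _ := rfl
  comp_id _ := rfl
  assoc _ _ _ := rfl
  leftUnitor_eqToIso _ := rfl
  rightUnitor_eqToIso _ := rfl
  associator_eqToIso _ _ _ := rfl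

/-- The forgetful 2-functor from rectangular torsion theories to pointed categories. -/
def forget : StrictPseudofunctor TorR.{v, u} PointCat.{v, u} :=
  StrictPseudofunctor.mk'' {
    obj P := P.base
    map {P Q} F := ⟨F.obj, fun X hX => by
      have h := (P.tors_and_free_iff X).2 hX
      exact (Q.tors_and_free_iff _).1 ⟨F.property.map_tors X h.1, F.property.map_free X h.2⟩⟩
    map₂ α := ObjectProperty.homMk α.hom
    map_id _ := rfl
    map_comp _ _ := rfl
    map₂_id _ := rfl
    map₂_comp _ _ := rfl
    map₂_whisker_left _ _ _ _ := ((Category.id_comp _).trans (Category.comp_id _)).symm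
    map₂_whisker_right _ _ := ((Category.id_comp _).trans (Category.comp_id _)).symm }

end TorR

end RTT

namespace RTT

/-! Write Q for the action of a pseudo-algebra and θ : X ≅ Q(X, X) for its unit. Conjugating Q by θ
gives an operation `glue u v` on parallel morphisms, hence natural orthogonal idempotents t = `glue
1 0` and f = `glue 0 1`. The multiplication sees only the outer components, so its naturality and
the unit laws give Q(t, f) = 1 (`map_t_f`). Therefore a morphism is determined by its composites
with t and f (`hom_ext`), and these composites can be prescribed independently (`t_glue`, `f_glue`).

The idempotents split through Q(X, 0) and Q(0, X); the splittings are the torsion and torsion-free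
parts, and the two classes are given by t = 1 and f = 1. Then Γ is faithful by `hom_ext`, full by
gluing, and essentially surjective because Q(X, Y) hits (X, Y).

Conversely, an equivalence C ≌ 𝒯 × ℱ transports the projection onto outer components to an action on
C (`ofEquivalence`); its coherence is naturality of the counit together with the triangle
identities. For the action obtained from Γ, `Γ_map_glue` identifies `glue` with mixing the two
components of Γ, and so the original classes are recovered (`isTorsion_iff`, `isTorsionFree_iff`).

On 1-cells, both notions of morphism mean that the functor commutes with t and f
(`isMorphism_theory_iff`, `commutes_of_pseudoMorphism`, `pseudoMorphismMk`). The structure 2-cell of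
a pseudo-morphism is no extra datum: naturality and the unit axiom force it to be `comparison`
(`eq_comparison`), with which every natural transformation is compatible (`homMk₂`). So over pointed
categories both sides amount to a property of functors, with all natural transformations as 2-cells,
and identity functors carry the required 2-natural isomorphisms. -/

/-- The 1-categorical data of a pseudo-algebra structure `Q = obj` for the square 2-monad on a
category with zero morphisms. -/
structure RectBand (C : Type u) [Category.{v} C] [HasZeroMorphisms C] where
  obj : C → C → C
  map {a a' b b' : C} : (a ⟶ a') → (b ⟶ b') → (obj a b ⟶ obj a' b')
  map_id (a b : C) : map (𝟙 a) (𝟙 b) = 𝟙 (obj a b)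
  map_comp {a a' a'' b b' b'' : C} (f : a ⟶ a') (f' : a' ⟶ a'') (g : b ⟶ b') (g' : b' ⟶ b'') :
    map f g ≫ map f' g' = map (f ≫ f') (g ≫ g')
  map_zero (a a' b b' : C) : map (0 : a ⟶ a') (0 : b ⟶ b') = 0
  θ (X : C) : X ≅ obj X X
  θ_nat {X Y : C} (f : X ⟶ Y) : f ≫ (θ Y).hom = (θ X).hom ≫ map f f
  -- Invertibility and associativity coherence of μ are left out: naturality and the right unit law
  -- already determine μ from the remaining data, see `map_fst_snd`.
  μ (a b c d : C) : obj (obj a b) (obj c d) ⟶ obj a d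
  μ_nat {a a' b b' c c' d d' : C} (f : a ⟶ a') (g : b ⟶ b') (h : c ⟶ c') (k : d ⟶ d') :
    map (map f g) (map h k) ≫ μ a' b' c' d' = μ a b c d ≫ map f k
  left_unit (a b : C) : (θ (obj a b)).hom ≫ μ a b a b = 𝟙 (obj a b)
  right_unit (a b : C) : map (θ a).hom (θ b).hom ≫ μ a a b b = 𝟙 (obj a b)

/-! ### The gluing operation and the idempotents t and f -/

namespace RectBand

attribute [simp] map_id map_zero map_comp

variable {C : Type u₁} [Category.{v₁} C] [HasZeroMorphisms C] (B : RectBand C)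

@[simp]
theorem map_comp_assoc {a a' a'' b b' b'' Z : C} (f : a ⟶ a') (f' : a' ⟶ a'') (g : b ⟶ b')
    (g' : b' ⟶ b'') (k : B.obj a'' b'' ⟶ Z) :
    B.map f g ≫ B.map f' g' ≫ k = B.map (f ≫ f') (g ≫ g') ≫ k := by
  rw [← Category.assoc, map_comp]

theorem θ_nat_assoc {X Y Z : C} (f : X ⟶ Y) (k : B.obj Y Y ⟶ Z) :
    f ≫ (B.θ Y).hom ≫ k = (B.θ X).hom ≫ B.map f f ≫ k := by
  rw [← Category.assoc, θ_nat, Category.assoc]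

theorem left_unit_assoc {a b Z : C} (k : B.obj a b ⟶ Z) :
    (B.θ (B.obj a b)).hom ≫ B.μ a b a b ≫ k = k := by
  rw [← Category.assoc, left_unit, Category.id_comp]

theorem map_θ_inv {X Y : C} (f : X ⟶ Y) : B.map f f ≫ (B.θ Y).inv = (B.θ X).inv ≫ f := by
  rw [Iso.comp_inv_eq, Category.assoc, B.θ_nat, Iso.inv_hom_id_assoc]

/-- The left unit law exhibits μ as a one-sided inverse of the isomorphism θ, hence as its inverse.
-/
theorem θ_inv_obj (a b : C) : (B.θ (B.obj a b)).inv = B.μ a b a b := by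
  rw [← cancel_epi (B.θ (B.obj a b)).hom, Iso.hom_inv_id, left_unit]

theorem map_θ_inv_θ_inv (a b : C) : B.map (B.θ a).inv (B.θ b).inv = B.μ a a b b := by
  rw [← Category.comp_id (B.map _ _), ← B.right_unit, map_comp_assoc, Iso.inv_hom_id,
    Iso.inv_hom_id, map_id, Category.id_comp]

/-- The morphism `X ⟶ Y` which agrees with `u` on torsion parts and with `v` on torsion-free
parts. -/
def glue {X Y : C} (u v : X ⟶ Y) : X ⟶ Y := (B.θ X).hom ≫ B.map u v ≫ (B.θ Y).inv

theorem glue_self {X Y : C} (u : X ⟶ Y) : B.glue u u = u := by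
  simp [glue, map_θ_inv]

/-- The inner θ and its inverse cancel, so only functoriality of Q is left. Combined with
`glue_self`, this lets composition with any morphism pass through `glue` on either side. -/
theorem glue_comp_glue {X Y Z : C} (u v : X ⟶ Y) (u' v' : Y ⟶ Z) :
    B.glue u v ≫ B.glue u' v' = B.glue (u ≫ u') (v ≫ v') := by
  simp [glue]

theorem glue_comp {X Y Z : C} (u v : X ⟶ Y) (g : Y ⟶ Z) :
    B.glue u v ≫ g = B.glue (u ≫ g) (v ≫ g) := by
  conv_lhs => rw [← B.glue_self g, glue_comp_glue]

theorem comp_glue {X Y Z : C} (g : X ⟶ Y) (u v : Y ⟶ Z) :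
    g ≫ B.glue u v = B.glue (g ≫ u) (g ≫ v) := by
  conv_lhs => rw [← B.glue_self g, glue_comp_glue]

@[simp]
theorem glue_zero (X Y : C) : B.glue (0 : X ⟶ Y) 0 = 0 := by simp [glue]

/-- The projection onto the torsion part, as an idempotent. -/
def t (X : C) : X ⟶ X := B.glue (𝟙 X) 0

/-- The projection onto the torsion-free part, as an idempotent. -/
def f (X : C) : X ⟶ X := B.glue 0 (𝟙 X)

theorem t_comp {X Y : C} (g : X ⟶ Y) : B.t X ≫ g = B.glue g 0 := by simp [t, glue_comp]

theorem f_comp {X Y : C} (g : X ⟶ Y) : B.f X ≫ g = B.glue 0 g := by simp [f, glue_comp]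

theorem comp_t {X Y : C} (g : X ⟶ Y) : g ≫ B.t Y = B.t X ≫ g := by
  simp [t, comp_glue, glue_comp]

theorem comp_t_assoc {X Y Z : C} (g : X ⟶ Y) (k : Y ⟶ Z) :
    g ≫ B.t Y ≫ k = B.t X ≫ g ≫ k := by
  rw [← Category.assoc, comp_t, Category.assoc]

theorem comp_f {X Y : C} (g : X ⟶ Y) : g ≫ B.f Y = B.f X ≫ g := by
  simp [f, comp_glue, glue_comp]

theorem comp_f_assoc {X Y Z : C} (g : X ⟶ Y) (k : Y ⟶ Z) :
    g ≫ B.f Y ≫ k = B.f X ≫ g ≫ k := by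
  rw [← Category.assoc, comp_f, Category.assoc]

@[simp] theorem t_t (X : C) : B.t X ≫ B.t X = B.t X := by simp [t, glue_comp_glue]
@[simp] theorem f_f (X : C) : B.f X ≫ B.f X = B.f X := by simp [f, glue_comp_glue]
@[simp] theorem t_f (X : C) : B.t X ≫ B.f X = 0 := by simp [t, f, glue_comp_glue]

@[simp] theorem t_t_assoc {X Y : C} (k : X ⟶ Y) : B.t X ≫ B.t X ≫ k = B.t X ≫ k := by
  rw [← Category.assoc, t_t]

@[simp] theorem f_f_assoc {X Y : C} (k : X ⟶ Y) : B.f X ≫ B.f X ≫ k = B.f X ≫ k := by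
  rw [← Category.assoc, f_f]

@[simp] theorem t_f_assoc {X Y : C} (k : X ⟶ Y) : B.t X ≫ B.f X ≫ k = 0 := by
  rw [← Category.assoc, t_f, zero_comp]

/-- Expanding t and f gives Q(θ, θ), then Q(Q(1, 0), Q(0, 1)), then Q(θ⁻¹, θ⁻¹). The last factor is
a component of μ, so naturality of μ discards the two inner zeros, and what remains is the right
unit law. All separation and independence of the two parts comes from this identity. -/
theorem map_t_f (X Y : C) : B.map (B.t X) (B.f Y) = 𝟙 (B.obj X Y) := by
  simp only [t, f, glue, ← B.map_comp]
  rw [map_θ_inv_θ_inv, μ_nat, map_id, Category.comp_id, right_unit]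

theorem glue_t_f {X Y : C} (u v : X ⟶ Y) : B.glue (B.t X ≫ u) (B.f X ≫ v) = B.glue u v := by
  simp [glue, ← B.map_comp, map_t_f]

theorem t_glue {X Y : C} (u v : X ⟶ Y) : B.t X ≫ B.glue u v = B.t X ≫ u := by
  rw [B.t_comp u, t, glue_comp_glue, Category.id_comp, zero_comp]

theorem t_glue_assoc {X Y Z : C} (u v : X ⟶ Y) (k : Y ⟶ Z) :
    B.t X ≫ B.glue u v ≫ k = B.t X ≫ u ≫ k := by
  rw [← Category.assoc, t_glue, Category.assoc]

theorem f_glue {X Y : C} (u v : X ⟶ Y) : B.f X ≫ B.glue u v = B.f X ≫ v := by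
  rw [B.f_comp v, f, glue_comp_glue, Category.id_comp, zero_comp]

theorem f_glue_assoc {X Y Z : C} (u v : X ⟶ Y) (k : Y ⟶ Z) :
    B.f X ≫ B.glue u v ≫ k = B.f X ≫ v ≫ k := by
  rw [← Category.assoc, f_glue, Category.assoc]

/-- Since Q(t, f) = 1, g = `glue g g` = `glue (t ≫ g) (f ≫ g)`, which involves only the two
composites. -/
theorem hom_ext {X Y : C} {g h : X ⟶ Y} (ht : B.t X ≫ g = B.t X ≫ h)
    (hf : B.f X ≫ g = B.f X ≫ h) : g = h := by
  rw [← B.glue_self g, ← B.glue_t_f, ht, hf, glue_t_f, glue_self]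

/-- On Q(a, b) the inverse of θ is μ, and naturality of μ at (1, 1, 0, 0) keeps the outer entries 1
and 0. -/
theorem t_obj (a b : C) : B.t (B.obj a b) = B.map (𝟙 a) 0 := by
  have := B.μ_nat (𝟙 a) (𝟙 b) (0 : a ⟶ a) (0 : b ⟶ b)
  rw [map_id, map_zero] at this
  rw [t, glue, θ_inv_obj, this, left_unit_assoc]

theorem f_obj (a b : C) : B.f (B.obj a b) = B.map 0 (𝟙 b) := by
  have := B.μ_nat (0 : a ⟶ a) (0 : b ⟶ b) (𝟙 a) (𝟙 b)
  rw [map_id, map_zero] at this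
  rw [f, glue, θ_inv_obj, this, left_unit_assoc]

/-! ### Projections and injections of Q(a, b) -/

/-- The torsion part of `Q(a, b)`, mapped to `a`. -/
def fst (a b : C) : B.obj a b ⟶ a := B.map (𝟙 a) 0 ≫ (B.θ a).inv

/-- The torsion-free part of `Q(a, b)`, mapped to `b`. -/
def snd (a b : C) : B.obj a b ⟶ b := B.map 0 (𝟙 b) ≫ (B.θ b).inv

/-- The torsion part of `a`, mapped to `Q(a, b)`. -/
def inl (a b : C) : a ⟶ B.obj a b := (B.θ a).hom ≫ B.map (𝟙 a) 0

/-- The torsion-free part of `b`, mapped to `Q(a, b)`. -/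
def inr (a b : C) : b ⟶ B.obj a b := (B.θ b).hom ≫ B.map 0 (𝟙 b)

@[simp] theorem inl_fst (a b : C) : B.inl a b ≫ B.fst a b = B.t a := by
  simp [inl, fst, t, glue]
@[simp] theorem inr_snd (a b : C) : B.inr a b ≫ B.snd a b = B.f b := by
  simp [inr, snd, f, glue]
@[simp] theorem inl_snd (a b : C) : B.inl a b ≫ B.snd a b = 0 := by
  simp [inl, snd]
@[simp] theorem inr_fst (a b : C) : B.inr a b ≫ B.fst a b = 0 := by
  simp [inr, fst]
@[simp] theorem fst_inl (a b : C) : B.fst a b ≫ B.inl a b = B.t (B.obj a b) := by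
  simp [inl, fst, t_obj]
@[simp] theorem snd_inr (a b : C) : B.snd a b ≫ B.inr a b = B.f (B.obj a b) := by
  simp [inr, snd, f_obj]

@[simp] theorem fst_inl_assoc {a b Z : C} (k : B.obj a b ⟶ Z) :
    B.fst a b ≫ B.inl a b ≫ k = B.t (B.obj a b) ≫ k := by
  rw [← Category.assoc, fst_inl]

@[simp] theorem snd_inr_assoc {a b Z : C} (k : B.obj a b ⟶ Z) :
    B.snd a b ≫ B.inr a b ≫ k = B.f (B.obj a b) ≫ k := by
  rw [← Category.assoc, snd_inr]

theorem inl_nat {a a' b b' : C} (g : a ⟶ a') (h : b ⟶ b') :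
    B.inl a b ≫ B.map g h = g ≫ B.inl a' b' := by
  simp [inl, B.θ_nat_assoc]

theorem inr_nat {a a' b b' : C} (g : a ⟶ a') (h : b ⟶ b') :
    B.inr a b ≫ B.map g h = h ≫ B.inr a' b' := by
  simp [inr, B.θ_nat_assoc]

theorem inl_self (X : C) : B.inl X X = B.t X ≫ (B.θ X).hom := by simp [inl, t, glue]

theorem inr_self (X : C) : B.inr X X = B.f X ≫ (B.θ X).hom := by simp [inr, f, glue]

/-- Naturality of μ along (1, 1, 0, 0) moves the computation to Q(Q(a, b), Q(a, b)), where μ cancels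
θ. -/
theorem inl_μ (a b c d : C) :
    B.inl (B.obj a b) (B.obj c d) ≫ B.μ a b c d = B.fst a b ≫ B.inl a d := by
  have := B.μ_nat (𝟙 a) (𝟙 b) (0 : a ⟶ c) (0 : b ⟶ d)
  rw [map_id, map_zero] at this
  rw [inl, Category.assoc, this, left_unit_assoc]
  simp [fst, inl]

theorem inr_μ (a b c d : C) :
    B.inr (B.obj a b) (B.obj c d) ≫ B.μ a b c d = B.snd c d ≫ B.inr a d := by
  have := B.μ_nat (0 : c ⟶ a) (0 : d ⟶ b) (𝟙 c) (𝟙 d)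
  rw [map_id, map_zero] at this
  rw [inr, Category.assoc, this, left_unit_assoc]
  simp [snd, inr]

/-- The factor Q(θ⁻¹, θ⁻¹) is itself a component of μ, and naturality removes the zeros in the inner
positions. Thus μ is expressed through Q and θ alone. -/
theorem map_fst_snd (a b c d : C) : B.map (B.fst a b) (B.snd c d) = B.μ a b c d := by
  rw [fst, snd, ← map_comp, map_θ_inv_θ_inv, μ_nat, map_id, Category.comp_id]

/-! ### The rectangular torsion theory of a band -/

/-- A splitting of the idempotent `t X`. -/
structure TorsionPart (X : C) where
  obj : C
  l : obj ⟶ X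
  p : X ⟶ obj
  l_p : l ≫ p = 𝟙 obj
  p_l : p ≫ l = B.t X

/-- A splitting of the idempotent `f X`. -/
structure TorsionFreePart (X : C) where
  obj : C
  r : X ⟶ obj
  s : obj ⟶ X
  r_s : r ≫ s = B.f X
  s_r : s ≫ r = 𝟙 obj

attribute [simp] TorsionPart.l_p TorsionPart.p_l TorsionFreePart.r_s TorsionFreePart.s_r

variable {B}

@[simp] theorem TorsionPart.l_p_assoc {X Z : C} (A : B.TorsionPart X) (k : A.obj ⟶ Z) :
    A.l ≫ A.p ≫ k = k := by
  rw [← Category.assoc, TorsionPart.l_p, Category.id_comp]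

@[simp] theorem TorsionPart.p_l_assoc {X Z : C} (A : B.TorsionPart X) (k : X ⟶ Z) :
    A.p ≫ A.l ≫ k = B.t X ≫ k := by
  rw [← Category.assoc, TorsionPart.p_l]

@[simp] theorem TorsionFreePart.r_s_assoc {X Z : C} (A : B.TorsionFreePart X) (k : X ⟶ Z) :
    A.r ≫ A.s ≫ k = B.f X ≫ k := by
  rw [← Category.assoc, TorsionFreePart.r_s]

@[simp] theorem TorsionFreePart.s_r_assoc {X Z : C} (A : B.TorsionFreePart X) (k : A.obj ⟶ Z) :
    A.s ≫ A.r ≫ k = k := by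
  rw [← Category.assoc, TorsionFreePart.s_r, Category.id_comp]

@[simp]
theorem TorsionPart.l_t {X : C} (A : B.TorsionPart X) : A.l ≫ B.t X = A.l := by
  rw [← A.p_l, A.l_p_assoc]

@[simp]
theorem TorsionPart.t_p {X : C} (A : B.TorsionPart X) : B.t X ≫ A.p = A.p := by
  rw [← A.p_l, Category.assoc, A.l_p, Category.comp_id]

@[simp]
theorem TorsionFreePart.f_r {X : C} (A : B.TorsionFreePart X) : B.f X ≫ A.r = A.r := by
  rw [← A.r_s, Category.assoc, A.s_r, Category.comp_id]

@[simp]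
theorem TorsionFreePart.s_f {X : C} (A : B.TorsionFreePart X) : A.s ≫ B.f X = A.s := by
  rw [← A.r_s, A.s_r_assoc]

@[simp] theorem TorsionPart.l_t_assoc {X Z : C} (A : B.TorsionPart X) (k : X ⟶ Z) :
    A.l ≫ B.t X ≫ k = A.l ≫ k := by
  rw [← Category.assoc, TorsionPart.l_t]

@[simp] theorem TorsionPart.t_p_assoc {X Z : C} (A : B.TorsionPart X) (k : A.obj ⟶ Z) :
    B.t X ≫ A.p ≫ k = A.p ≫ k := by
  rw [← Category.assoc, TorsionPart.t_p]

@[simp] theorem TorsionFreePart.f_r_assoc {X Z : C} (A : B.TorsionFreePart X) (k : A.obj ⟶ Z) :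
    B.f X ≫ A.r ≫ k = A.r ≫ k := by
  rw [← Category.assoc, TorsionFreePart.f_r]

@[simp] theorem TorsionFreePart.s_f_assoc {X Z : C} (A : B.TorsionFreePart X) (k : X ⟶ Z) :
    A.s ≫ B.f X ≫ k = A.s ≫ k := by
  rw [← Category.assoc, TorsionFreePart.s_f]

theorem TorsionPart.t_obj {X : C} (A : B.TorsionPart X) : B.t A.obj = 𝟙 A.obj := by
  rw [← Category.comp_id (B.t A.obj), ← A.l_p, ← B.comp_t_assoc, A.t_p]

theorem TorsionFreePart.f_obj {X : C} (A : B.TorsionFreePart X) : B.f A.obj = 𝟙 A.obj := by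
  rw [← Category.id_comp (B.f A.obj), ← A.s_r, Category.assoc, B.comp_f, A.f_r]

/-- If g ≫ r = 0 then the f-part of g vanishes, so g equals its t-part and passes through the
splitting of t; the cokernel property is dual. Uniqueness holds because l is a split monomorphism
and r a split epimorphism. -/
theorem isShortExact {N : MorphismProperty C} (hN : ∀ {X Y : C} (f : X ⟶ Y), N f ↔ f = 0)
    {X : C} (A : B.TorsionPart X) (A' : B.TorsionFreePart X) : IsShortExact N A.l A'.r := by
  have h : A.l ≫ A'.r = 0 := by
    rw [← A.l_t, ← A'.f_r, Category.assoc, t_f_assoc, comp_zero]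
  refine ⟨⟨(hN _).2 h, fun W g hg => ⟨g ≫ A.p, ?_, fun y hy => ?_⟩⟩,
    ⟨(hN _).2 h, fun W g hg => ⟨A'.s ≫ g, ?_, fun y hy => ?_⟩⟩⟩
  · rw [hN] at hg
    refine B.hom_ext ?_ ?_
    · simp [B.comp_t]
    · simp only [← B.comp_f, Category.assoc, A.p_l]
      rw [t_f, ← A'.r_s, reassoc_of% hg, zero_comp, comp_zero]
  · simp [← hy]
  · rw [hN] at hg
    refine B.hom_ext ?_ ?_
    · rw [A'.r_s_assoc, t_f_assoc, ← A.p_l, Category.assoc, hg, comp_zero]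
    · simp
  · simp [← hy]

end RectBand

theorem factorsThrough_iff_eq_zero {C : Type u} [Category.{v} C] [HasZeroMorphisms C]
    [HasZeroObject C] {Z : ObjectProperty C} (hZ : ∀ X, Z X ↔ IsZero X) {X Y : C} (g : X ⟶ Y) :
    factorsThrough Z g ↔ g = 0 := by
  constructor
  · rintro ⟨W, hW, a, b, rfl⟩
    rw [((hZ W).1 hW).eq_of_tgt a 0, zero_comp]
  · rintro rfl
    obtain ⟨W, hW⟩ := HasZeroObject.zero (C := C)
    exact ⟨W, (hZ W).2 hW, 0, 0, zero_comp⟩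

namespace RectBand

variable {C : Type u₁} [Category.{v₁} C] [HasZeroMorphisms C] (B : RectBand C)

/-- The objects whose torsion-free part vanishes. -/
def IsTorsion : ObjectProperty C := fun X => B.t X = 𝟙 X

/-- The objects whose torsion part vanishes. -/
def IsTorsionFree : ObjectProperty C := fun X => B.f X = 𝟙 X

theorem isTorsion_of_iso {X Y : C} (e : X ≅ Y) (h : B.IsTorsion X) : B.IsTorsion Y := by
  dsimp only [IsTorsion] at h ⊢
  rw [← cancel_epi e.hom, B.comp_t, h, Category.id_comp, Category.comp_id]

theorem isTorsionFree_of_iso {X Y : C} (e : X ≅ Y) (h : B.IsTorsionFree X) :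
    B.IsTorsionFree Y := by
  dsimp only [IsTorsionFree] at h ⊢
  rw [← cancel_epi e.hom, B.comp_f, h, Category.id_comp, Category.comp_id]

theorem eq_zero_of_isTorsion_of_isTorsionFree {X Y : C} (hX : B.IsTorsion X)
    (hY : B.IsTorsionFree Y) (g : X ⟶ Y) : g = 0 := by
  rw [← Category.id_comp g, ← hX, ← Category.comp_id g, ← hY, B.comp_f, t_f_assoc]

theorem isTorsion_and_isTorsionFree_iff (X : C) :
    B.IsTorsion X ∧ B.IsTorsionFree X ↔ IsZero X := by
  constructor
  · rintro ⟨h, h'⟩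
    exact (IsZero.iff_id_eq_zero X).2 (B.eq_zero_of_isTorsion_of_isTorsionFree h h' _)
  · exact fun h => ⟨h.eq_of_src _ _, h.eq_of_src _ _⟩

open ZeroObject in
-- The case distinction serves the normalization: a torsion object is its own torsion part.
-- Otherwise t splits through Q(X, 0), where t is Q(1, 0), and this is the identity because 0 = 1 on
-- the zero object.
theorem exists_torsionPart [HasZeroObject C] (X : C) :
    ∃ A : B.TorsionPart X, B.IsTorsion X → ∃ h : A.obj = X, A.l = eqToHom h := by
  by_cases h : B.IsTorsion X
  · exact ⟨⟨X, 𝟙 X, 𝟙 X, by simp, by rw [Category.id_comp]; exact h.symm⟩, fun _ => ⟨rfl, rfl⟩⟩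
  · refine ⟨⟨B.obj X 0, B.fst X 0, B.inl X 0, ?_, by simp⟩, fun h' => absurd h' h⟩
    rw [fst_inl, t_obj, ← B.map_id]
    congr 1
    exact (isZero_zero C).eq_of_src _ _

open ZeroObject in
theorem exists_torsionFreePart [HasZeroObject C] (X : C) :
    ∃ A : B.TorsionFreePart X, B.IsTorsionFree X → ∃ h : X = A.obj, A.r = eqToHom h := by
  by_cases h : B.IsTorsionFree X
  · exact ⟨⟨X, 𝟙 X, 𝟙 X, by rw [Category.id_comp]; exact h.symm, by simp⟩, fun _ => ⟨rfl, rfl⟩⟩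
  · refine ⟨⟨B.obj 0 X, B.inr 0 X, B.snd 0 X, by simp, ?_⟩, fun h' => absurd h' h⟩
    rw [snd_inr, f_obj, ← B.map_id]
    congr 1
    exact (isZero_zero C).eq_of_src _ _

variable [HasZeroObject C]

/-- A normalized choice of torsion parts. -/
noncomputable def torsionPart (X : C) : B.TorsionPart X := (B.exists_torsionPart X).choose

/-- A normalized choice of torsion-free parts. -/
noncomputable def torsionFreePart (X : C) : B.TorsionFreePart X :=
  (B.exists_torsionFreePart X).choose

theorem null_iff {X Y : C} (g : X ⟶ Y) :
    factorsThrough (B.IsTorsion ⊓ B.IsTorsionFree) g ↔ g = 0 :=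
  factorsThrough_iff_eq_zero B.isTorsion_and_isTorsionFree_iff g

/-- The pretorsion theory of a band. -/
noncomputable def theory : PretorsionTheory C where
  tors := B.IsTorsion
  free := B.IsTorsionFree
  tors_replete := ⟨B.isTorsion_of_iso⟩
  free_replete := ⟨B.isTorsionFree_of_iso⟩
  null_of_tors_of_free g hX hY :=
    (B.null_iff g).2 (B.eq_zero_of_isTorsion_of_isTorsionFree hX hY g)
  T X := (B.torsionPart X).obj
  F X := (B.torsionFreePart X).obj
  tors_T X := (B.torsionPart X).t_obj
  free_F X := (B.torsionFreePart X).f_obj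
  l X := (B.torsionPart X).l
  r X := (B.torsionFreePart X).r
  exact _ := isShortExact B.null_iff _ _
  l_of_tors X := (B.exists_torsionPart X).choose_spec
  r_of_free X := (B.exists_torsionFreePart X).choose_spec

theorem mapT_theory {X Y : C} (h : X ⟶ Y) :
    B.theory.mapT h = (B.torsionPart X).l ≫ h ≫ (B.torsionPart Y).p := by
  refine (B.theory.eq_mapT ?_).symm
  change _ ≫ (B.torsionPart Y).l = (B.torsionPart X).l ≫ h
  rw [Category.assoc, Category.assoc, TorsionPart.p_l, B.comp_t, TorsionPart.l_t_assoc]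

theorem mapF_theory {X Y : C} (h : X ⟶ Y) :
    B.theory.mapF h = (B.torsionFreePart X).s ≫ h ≫ (B.torsionFreePart Y).r := by
  refine (B.theory.eq_mapF ?_).symm
  change (B.torsionFreePart X).r ≫ _ = h ≫ (B.torsionFreePart Y).r
  rw [TorsionFreePart.r_s_assoc, ← B.comp_f_assoc, TorsionFreePart.f_r]

theorem theory_isRectangular : B.theory.IsRectangular := by
  have hF : B.theory.Γ.Faithful := by
    refine ⟨fun {X Y} g h e => ?_⟩
    have e₁ : B.theory.mapT g = B.theory.mapT h := congr(($e).1.hom)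
    have e₂ : B.theory.mapF g = B.theory.mapF h := congr(($e).2.hom)
    rw [mapT_theory, mapT_theory] at e₁
    rw [mapF_theory, mapF_theory] at e₂
    replace e₁ := congr((B.torsionPart X).p ≫ $e₁ ≫ (B.torsionPart Y).l)
    replace e₂ := congr((B.torsionFreePart X).r ≫ $e₂ ≫ (B.torsionFreePart Y).s)
    simp [B.comp_t] at e₁
    simp [B.comp_f] at e₂
    exact B.hom_ext e₁ e₂
  have hF' : B.theory.Γ.Full := by
    refine ⟨fun {X Y} g => ?_⟩
    let u : (B.torsionPart X).obj ⟶ (B.torsionPart Y).obj := g.1.hom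
    let v : (B.torsionFreePart X).obj ⟶ (B.torsionFreePart Y).obj := g.2.hom
    -- Lift u and v separately along the splittings and glue. Since l = l ≫ t and s = s ≫ f,
    -- restricting to either part picks out the matching lift.
    refine ⟨B.glue ((B.torsionPart X).p ≫ u ≫ (B.torsionPart Y).l)
      ((B.torsionFreePart X).r ≫ v ≫ (B.torsionFreePart Y).s), Prod.ext
        (ObjectProperty.hom_ext _ ((B.mapT_theory _).trans ?_))
        (ObjectProperty.hom_ext _ ((B.mapF_theory _).trans ?_))⟩
    · change _ = u
      rw [← TorsionPart.l_t_assoc, B.t_glue_assoc]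
      simp
    · change _ = v
      rw [← TorsionFreePart.s_f_assoc, B.f_glue_assoc]
      simp
  have hE : B.theory.Γ.EssSurj := by
    refine ⟨fun ⟨⟨X, hX⟩, ⟨Y, hY⟩⟩ => ?_⟩
    have hX' : B.t X = 𝟙 X := hX
    have hY' : B.f Y = 𝟙 Y := hY
    let A := B.torsionPart (B.obj X Y)
    let A' := B.torsionFreePart (B.obj X Y)
    refine ⟨B.obj X Y, ⟨Iso.prod (ObjectProperty.isoMk _ ⟨A.l ≫ B.fst X Y, B.inl X Y ≫ A.p, ?_, ?_⟩)
      (ObjectProperty.isoMk _ ⟨A'.s ≫ B.snd X Y, B.inr X Y ≫ A'.r, ?_, ?_⟩)⟩⟩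
    · exact (by simp : (A.l ≫ B.fst X Y) ≫ B.inl X Y ≫ A.p = 𝟙 A.obj)
    · exact (by simp [B.comp_t_assoc, hX'] : (B.inl X Y ≫ A.p) ≫ A.l ≫ B.fst X Y = 𝟙 X)
    · exact (by simp : (A'.s ≫ B.snd X Y) ≫ B.inr X Y ≫ A'.r = 𝟙 A'.obj)
    · exact (by simp [B.comp_f_assoc, hY'] : (B.inr X Y ≫ A'.r) ≫ A'.s ≫ B.snd X Y = 𝟙 Y)
  exact {}

end RectBand

/-! ### Functors between bands and the canonical comparison -/

namespace RectBand

variable {C : Type u₁} [Category.{v₁} C] [HasZeroMorphisms C]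
  {D : Type u₂} [Category.{v₂} D] [HasZeroMorphisms D]

/-- The functors which commute with the idempotents `t` and `f`. -/
structure Commutes (A : RectBand C) (B : RectBand D) (G : C ⥤ D) : Prop where
  map_t (X : C) : G.map (A.t X) = B.t (G.obj X)
  map_f (X : C) : G.map (A.f X) = B.f (G.obj X)

variable {A : RectBand C} {B : RectBand D} {G : C ⥤ D}

/-- The image of a torsion part. -/
def Commutes.torsionPart (h : Commutes A B G) {X : C} (P : A.TorsionPart X) :
    B.TorsionPart (G.obj X) where
  obj := G.obj P.obj
  l := G.map P.l
  p := G.map P.p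
  l_p := by rw [← G.map_comp, P.l_p, G.map_id]
  p_l := by rw [← G.map_comp, P.p_l, h.map_t]

/-- The image of a torsion-free part. -/
def Commutes.torsionFreePart (h : Commutes A B G) {X : C} (P : A.TorsionFreePart X) :
    B.TorsionFreePart (G.obj X) where
  obj := G.obj P.obj
  r := G.map P.r
  s := G.map P.s
  r_s := by rw [← G.map_comp, P.r_s, h.map_f]
  s_r := by rw [← G.map_comp, P.s_r, G.map_id]

/-- The composite of t with G r has torsion-free target, hence is zero, so t factors through the
kernel G l and absorbs G t. Conversely G t factors through a torsion object and absorbs t. As t is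
natural the two composites agree, so G t = t; the argument for f is dual. Preservation of zero
morphisms by G is not needed. -/
theorem commutes_of_isShortExact {N : MorphismProperty D}
    (hN : ∀ {X Y : D} (g : X ⟶ Y), N g ↔ g = 0) {X : C} (P : A.TorsionPart X)
    (R : A.TorsionFreePart X) (hP : B.IsTorsion (G.obj P.obj))
    (hR : B.IsTorsionFree (G.obj R.obj)) (h : IsShortExact N (G.map P.l) (G.map R.r)) :
    G.map (A.t X) = B.t (G.obj X) ∧ G.map (A.f X) = B.f (G.obj X) := by
  dsimp only [IsTorsion, IsTorsionFree] at hP hR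
  constructor
  · obtain ⟨w, hw, -⟩ := h.isKernel.2 (B.t (G.obj X)) (by
      rw [hN, ← B.comp_t, ← Category.comp_id (B.t _), ← hR, t_f, comp_zero])
    have h₁ : B.t (G.obj X) ≫ G.map (A.t X) = B.t (G.obj X) := by
      rw [← hw, Category.assoc, ← G.map_comp, P.l_t]
    rw [← h₁, ← B.comp_t, ← P.p_l, G.map_comp, Category.assoc, B.comp_t, reassoc_of% hP]
  · obtain ⟨w, hw, -⟩ := h.isCokernel.2 (B.f (G.obj X)) (by
      rw [hN, B.comp_f, ← Category.id_comp (B.f _), ← hP, Category.assoc, t_f_assoc])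
    have h₁ : G.map (A.f X) ≫ B.f (G.obj X) = B.f (G.obj X) := by
      rw [← hw, ← G.map_comp_assoc, R.f_r]
    rw [← h₁, ← R.r_s, G.map_comp, Category.assoc, B.comp_f, reassoc_of% hR]

/-- The morphisms between the pretorsion theories of two bands are the functors which commute with
the idempotents. -/
theorem isMorphism_theory_iff [HasZeroObject C] [HasZeroObject D] :
    PretorsionTheory.IsMorphism A.theory B.theory G ↔ Commutes A B G := by
  constructor
  · intro h
    have key (X : C) := commutes_of_isShortExact B.null_iff (A.torsionPart X) (A.torsionFreePart X)
      (h.map_tors _ (A.theory.tors_T X)) (h.map_free _ (A.theory.free_F X)) (h.map_exact X)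
    exact ⟨fun X => (key X).1, fun X => (key X).2⟩
  · intro h
    refine ⟨fun X (hX : A.t X = 𝟙 X) => ?_, fun X (hX : A.f X = 𝟙 X) => ?_, fun X => ?_⟩
    · change B.t _ = _
      rw [← h.map_t, hX, G.map_id]
    · change B.f _ = _
      rw [← h.map_f, hX, G.map_id]
    · exact isShortExact B.null_iff (h.torsionPart (A.torsionPart X))
        (h.torsionFreePart (A.torsionFreePart X))

variable (A B G)

/-- The comparison `Q'(G a, G b) ⟶ G Q(a, b)`. -/
def comparison (a b : C) : B.obj (G.obj a) (G.obj b) ⟶ G.obj (A.obj a b) :=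
  B.map (G.map (A.inl a b)) (G.map (A.inr a b)) ≫ (B.θ _).inv

variable {A B G}

theorem comparison_nat {a a' b b' : C} (g : a ⟶ a') (h : b ⟶ b') :
    B.map (G.map g) (G.map h) ≫ comparison A B G a' b' =
      comparison A B G a b ≫ G.map (A.map g h) := by
  simp only [comparison, map_comp_assoc, ← G.map_comp, ← A.inl_nat g h, ← A.inr_nat g h,
    Category.assoc, ← B.map_θ_inv]

theorem comparison_app {H : C ⥤ D} (α : G ⟶ H) (a b : C) :
    B.map (α.app a) (α.app b) ≫ comparison A B H a b =
      comparison A B G a b ≫ α.app (A.obj a b) := by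
  simp only [comparison, map_comp_assoc, ← α.naturality, Category.assoc, ← B.map_θ_inv]

theorem comp_map_θ_inv {X : C} {φ : B.obj (G.obj X) (G.obj X) ⟶ G.obj (A.obj X X)}
    (hφ : (B.θ (G.obj X)).hom ≫ φ = G.map (A.θ X).hom) :
    φ ≫ G.map (A.θ X).inv = (B.θ (G.obj X)).inv := by
  rw [← cancel_epi (B.θ (G.obj X)).hom, reassoc_of% hφ, ← G.map_comp, Iso.hom_inv_id,
    Iso.hom_inv_id, G.map_id]

/-- The structure 2-cell of a pseudo-morphism is uniquely determined. -/
theorem eq_comparison (φ : ∀ a b, B.obj (G.obj a) (G.obj b) ⟶ G.obj (A.obj a b))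
    (hφ : ∀ {a a' b b' : C} (g : a ⟶ a') (h : b ⟶ b'),
      B.map (G.map g) (G.map h) ≫ φ a' b' = φ a b ≫ G.map (A.map g h))
    (hθ : ∀ X, (B.θ (G.obj X)).hom ≫ φ X X = G.map (A.θ X).hom) (a b : C) :
    φ a b = comparison A B G a b := by
  have h := hφ (A.inl a b) (A.inr a b)
  -- The identity of Q(a, b) is thereby written through Q(X, X) with X = Q(a, b), so naturality
  -- reduces φ to a diagonal component, which the unit axiom fixes.
  have h' : A.map (A.inl a b) (A.inr a b) ≫ (A.θ (A.obj a b)).inv = 𝟙 _ := by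
    rw [θ_inv_obj, ← map_fst_snd, map_comp, inl_fst, inr_snd, map_t_f]
  rw [comparison, ← comp_map_θ_inv (hθ _), reassoc_of% h, ← G.map_comp, h', G.map_id,
    Category.comp_id]

/-- Naturality and the unit axiom make G preserve `glue`; as G preserves 1 and 0, it preserves t and
f. -/
theorem commutes_of_comparison (φ : ∀ a b, B.obj (G.obj a) (G.obj b) ⟶ G.obj (A.obj a b))
    (hG : ∀ X Y : C, G.map (0 : X ⟶ Y) = 0)
    (hφ : ∀ {a a' b b' : C} (g : a ⟶ a') (h : b ⟶ b'),
      B.map (G.map g) (G.map h) ≫ φ a' b' = φ a b ≫ G.map (A.map g h))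
    (hθ : ∀ X, (B.θ (G.obj X)).hom ≫ φ X X = G.map (A.θ X).hom) : Commutes A B G := by
  have key {X Y : C} (g h : X ⟶ Y) : G.map (A.glue g h) = B.glue (G.map g) (G.map h) := by
    have := hφ g h
    simp only [glue, G.map_comp, ← hθ, Category.assoc, ← reassoc_of% this]
    rw [comp_map_θ_inv (hθ _)]
  exact ⟨fun X => by rw [t, key, G.map_id, hG, t], fun X => by rw [f, key, G.map_id, hG, f]⟩

theorem Commutes.unit_comparison (h : Commutes A B G) (X : C) :
    (B.θ (G.obj X)).hom ≫ comparison A B G X X = G.map (A.θ X).hom := by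
  rw [comparison, inl_self, inr_self, G.map_comp, G.map_comp, ← map_comp, h.map_t, h.map_f,
    map_t_f, Category.id_comp, ← B.θ_nat_assoc, Iso.hom_inv_id, Category.comp_id]

/-- The comparison of a functor which commutes with the idempotents is invertible. -/
def Commutes.comparisonIso (h : Commutes A B G) (a b : C) :
    B.obj (G.obj a) (G.obj b) ≅ G.obj (A.obj a b) where
  hom := comparison A B G a b
  inv := (B.θ _).hom ≫ B.map (G.map (A.fst a b)) (G.map (A.snd a b))
  hom_inv_id := by
    simp [comparison, ← G.map_comp, h.map_t, h.map_f, map_t_f]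
  inv_hom_id := by
    simp [comparison, ← G.map_comp, h.map_t, h.map_f, map_t_f]

/-- The composite is Q(t, 0) followed by θ⁻¹, and the extra t is absorbed by inserting Q(t, f) = 1.
-/
theorem Commutes.comparison_fst (h : Commutes A B G) (hG : ∀ X Y : C, G.map (0 : X ⟶ Y) = 0)
    (a b : C) : comparison A B G a b ≫ G.map (A.fst a b) = B.fst (G.obj a) (G.obj b) := by
  rw [comparison, Category.assoc, ← map_θ_inv, map_comp_assoc, ← G.map_comp, ← G.map_comp, inl_fst,
    inr_fst, hG, h.map_t, fst]
  rw [← Category.id_comp (B.map (𝟙 _) 0 ≫ _), ← map_t_f]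
  simp

theorem Commutes.comparison_snd (h : Commutes A B G) (hG : ∀ X Y : C, G.map (0 : X ⟶ Y) = 0)
    (a b : C) : comparison A B G a b ≫ G.map (A.snd a b) = B.snd (G.obj a) (G.obj b) := by
  rw [comparison, Category.assoc, ← map_θ_inv, map_comp_assoc, ← G.map_comp, ← G.map_comp, inl_snd,
    inr_snd, hG, h.map_f, snd]
  rw [← Category.id_comp (B.map 0 (𝟙 _) ≫ _), ← map_t_f]
  simp

/-- By `inl_μ` and `inr_μ`, G μ after the comparison depends only on the outer projections. The
comparison carries these to the projections of the target band, and `map_fst_snd` reassembles them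
into its multiplication. -/
theorem Commutes.mult_comparison (h : Commutes A B G) (hG : ∀ X Y : C, G.map (0 : X ⟶ Y) = 0)
    (a b c d : C) :
    B.map (comparison A B G a b) (comparison A B G c d) ≫
      comparison A B G (A.obj a b) (A.obj c d) ≫ G.map (A.μ a b c d) =
    B.μ (G.obj a) (G.obj b) (G.obj c) (G.obj d) ≫ comparison A B G a d := by
  have e : comparison A B G (A.obj a b) (A.obj c d) ≫ G.map (A.μ a b c d) =
      B.map (G.map (A.fst a b) ≫ G.map (A.inl a d)) (G.map (A.snd c d) ≫ G.map (A.inr a d)) ≫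
        (B.θ _).inv := by
    simp only [comparison, Category.assoc, ← map_θ_inv, map_comp_assoc, ← G.map_comp, inl_μ, inr_μ]
  rw [e, map_comp_assoc, ← Category.assoc, ← Category.assoc, h.comparison_fst hG,
    h.comparison_snd hG, ← map_comp, map_fst_snd, Category.assoc, comparison]

end RectBand

/-! ### Pseudo-algebras and pseudo-morphisms in terms of bands -/

noncomputable instance PointCat.hasZeroMorphisms (C : PointCat.{v, u}) :
    HasZeroMorphisms C.carrier :=
  HasZeroObject.zeroMorphismsOfZeroObject

theorem map_zero_of_preservesZeroObjects {C : Type u₁} [Category.{v₁} C] {D : Type u₂}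
    [Category.{v₂} D] [HasZeroMorphisms C] [HasZeroObject C] [HasZeroMorphisms D] {G : C ⥤ D}
    (hG : PreservesZeroObjects C D G) (X Y : C) : G.map (0 : X ⟶ Y) = 0 := by
  obtain ⟨Z, hZ⟩ := HasZeroObject.zero (C := C)
  have h : (0 : X ⟶ Y) = (0 : X ⟶ Z) ≫ (0 : Z ⟶ Y) := zero_comp.symm
  rw [h, G.map_comp, (hG Z hZ).eq_of_tgt (G.map _) 0, zero_comp]

namespace PointCat

open TwoMonad
open scoped CategoryTheory.Prod

variable (A : PseudoAlgebra squareMonad.{v, u})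

/-- The underlying functor of the structure map of a pseudo-algebra. -/
def actFunctor : A.carrier.carrier × A.carrier.carrier ⥤ A.carrier.carrier :=
  ObjectProperty.FullSubcategory.obj A.act

theorem actFunctor_preservesZeroObjects : PreservesZeroObjects _ _ (actFunctor A) :=
  ObjectProperty.FullSubcategory.property A.act

/-- The multiplication isomorphism of a pseudo-algebra. -/
def actMuIso : (actFunctor A).prod (actFunctor A) ⋙ actFunctor A ≅
    (CategoryTheory.Prod.fst A.carrier.carrier A.carrier.carrier).prod
      (CategoryTheory.Prod.snd A.carrier.carrier A.carrier.carrier) ⋙ actFunctor A :=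
  (ObjectProperty.ι _).mapIso A.actMu

/-- The unit isomorphism of a pseudo-algebra. -/
def actEtaIso : 𝟭 A.carrier.carrier ≅ Functor.diag A.carrier.carrier ⋙ actFunctor A :=
  (ObjectProperty.ι _).mapIso A.actEta

theorem hom_app_congr {C D : PointCat.{v, u}} {F G : C ⟶ D} {α β : F ⟶ G} (h : α = β)
    (X : C.carrier) : α.hom.app X = β.hom.app X := by rw [h]

/-- Strict equalities of 1-cells of `PointCat` used here hold by definition, so the `eqToHom` in the
coherence axiom has identity components, removed by `Category.id_comp`. -/
theorem actFunctor_left_unit (X : A.carrier.carrier × A.carrier.carrier) :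
    (actEtaIso A).hom.app ((actFunctor A).obj X) ≫ (actMuIso A).hom.app (X, X) = 𝟙 _ := by
  have h := hom_app_congr A.coh_unit_left X
  exact (congrArg _ (Category.id_comp _)).symm.trans h

theorem actFunctor_right_unit (X : A.carrier.carrier × A.carrier.carrier) :
    (actFunctor A).map ((actEtaIso A).hom.app X.1 ×ₘ (actEtaIso A).hom.app X.2) ≫
      (actMuIso A).hom.app ((X.1, X.1), (X.2, X.2)) = 𝟙 _ := by
  have h := hom_app_congr A.coh_unit_right X
  exact (congrArg _ (Category.id_comp _)).symm.trans h

/-- The band underlying a pseudo-algebra. -/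
def band : RectBand A.carrier.carrier where
  obj a b := (actFunctor A).obj (a, b)
  map g h := (actFunctor A).map (g ×ₘ h)
  map_id a b := (actFunctor A).map_id (a, b)
  map_comp g g' h h' := ((actFunctor A).map_comp (g ×ₘ h) (g' ×ₘ h')).symm
  map_zero a a' b b' := by
    obtain ⟨Z, hZ⟩ := HasZeroObject.zero (C := A.carrier.carrier)
    -- The action is only known to preserve zero objects, so the zero pair is factored through the
    -- zero object (Z, Z).
    have h : ((0 : a ⟶ a') ×ₘ (0 : b ⟶ b')) =
        ((0 : a ⟶ Z) ×ₘ (0 : b ⟶ Z)) ≫ ((0 : Z ⟶ a') ×ₘ (0 : Z ⟶ b')) := by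
      ext <;> simp
    rw [h, Functor.map_comp,
      ((actFunctor_preservesZeroObjects A) (Z, Z) (isZero_prod hZ hZ)).eq_of_tgt
        ((actFunctor A).map _) 0, zero_comp]
  θ X := (actEtaIso A).app X
  θ_nat g := (actEtaIso A).hom.naturality g
  μ a b c d := (actMuIso A).hom.app ((a, b), (c, d))
  μ_nat g h k l := (actMuIso A).hom.naturality ((g ×ₘ h) ×ₘ (k ×ₘ l))
  left_unit a b := actFunctor_left_unit A (a, b)
  right_unit a b := actFunctor_right_unit A (a, b)

variable {A} {A' : PseudoAlgebra squareMonad.{v, u}}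

theorem map_zero {C D : PointCat.{v, u}} (G : C ⟶ D) (X Y : C.carrier) :
    G.obj.map (0 : X ⟶ Y) = 0 :=
  map_zero_of_preservesZeroObjects G.property X Y

/-- The structure 2-cell of a pseudo-morphism. -/
def sqIso (G : PseudoMorphism squareMonad A A') :
    G.hom.obj.prod G.hom.obj ⋙ actFunctor A' ≅ actFunctor A ⋙ G.hom.obj :=
  (ObjectProperty.ι _).mapIso G.sq

theorem sqIso_unit (G : PseudoMorphism squareMonad A A') (X : A.carrier.carrier) :
    ((band A').θ (G.hom.obj.obj X)).hom ≫ (sqIso G).hom.app (X, X) =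
      G.hom.obj.map ((band A).θ X).hom := by
  have h := hom_app_congr G.coh_unit X
  exact ((congrArg _ (Category.id_comp _)).symm.trans h).trans
    ((Category.id_comp _).trans (Category.comp_id _))

theorem sqIso_nat (G : PseudoMorphism squareMonad A A') {a a' b b' : A.carrier.carrier}
    (g : a ⟶ a') (h : b ⟶ b') :
    (band A').map (G.hom.obj.map g) (G.hom.obj.map h) ≫ (sqIso G).hom.app (a', b') =
      (sqIso G).hom.app (a, b) ≫ G.hom.obj.map ((band A).map g h) :=
  (sqIso G).hom.naturality (g ×ₘ h)

theorem sqIso_eq_comparison (G : PseudoMorphism squareMonad A A') (a b : A.carrier.carrier) :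
    (sqIso G).hom.app (a, b) = RectBand.comparison (band A) (band A') G.hom.obj a b :=
  RectBand.eq_comparison (A := band A) (B := band A') (fun a b => (sqIso G).hom.app (a, b))
    (sqIso_nat G) (sqIso_unit G) a b

theorem commutes_of_pseudoMorphism (G : PseudoMorphism squareMonad A A') :
    RectBand.Commutes (band A) (band A') G.hom.obj :=
  RectBand.commutes_of_comparison (fun a b => (sqIso G).hom.app (a, b)) (map_zero G.hom)
    (sqIso_nat G) (sqIso_unit G)

/-- Every 2-cell between the underlying 1-cells of pseudo-morphisms is a 2-cell of
pseudo-morphisms. -/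
def homMk₂ {G H : PseudoMorphism squareMonad A A'} (α : G.hom ⟶ H.hom) : G ⟶ H where
  cell := α
  coh := by
    refine ObjectProperty.hom_ext _ (NatTrans.ext (funext fun X => ?_))
    -- Both structure cells are the canonical comparison, which is natural in the functor.
    have h := RectBand.comparison_app (A := band A) (B := band A') α.hom X.1 X.2
    rw [← sqIso_eq_comparison, ← sqIso_eq_comparison] at h
    exact h

/-- Both structure cells must be the canonical comparison. Equations between 1-cells in the
2-functors and 2-natural isomorphisms thus reduce to equations between functors. -/
theorem pseudoMorphism_ext {G H : PseudoMorphism squareMonad A A'} (h : G.hom = H.hom) : G = H := by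
  have hG := sqIso_eq_comparison G
  have hH := sqIso_eq_comparison H
  obtain ⟨G, φ, _, _⟩ := G
  obtain ⟨H, ψ, _, _⟩ := H
  dsimp only at h
  subst h
  refine PseudoMorphism.ext' rfl (ObjectProperty.hom_ext _ (NatTrans.ext (funext fun X => ?_)))
  exact (Category.comp_id _).trans (((hG X.1 X.2).trans (hH X.1 X.2).symm).trans
    (Category.id_comp _).symm)

/-- A 1-cell which commutes with the idempotents is a pseudo-morphism. -/
noncomputable def pseudoMorphismMk (G : A.carrier ⟶ A'.carrier)
    (hG : RectBand.Commutes (band A) (band A') G.obj) : PseudoMorphism squareMonad A A' where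
  hom := G
  sq := ObjectProperty.isoMk _ (NatIso.ofComponents
    (fun X => hG.comparisonIso X.1 X.2)
    (fun g => RectBand.comparison_nat (A := band A) (B := band A') (G := G.obj) g.1 g.2))
  coh_mult := by
    refine ObjectProperty.hom_ext _ (NatTrans.ext (funext fun X => ?_))
    have h := hG.mult_comparison (map_zero G) X.1.1 X.1.2 X.2.1 X.2.2
    refine Eq.trans ?_ (h.trans (Eq.trans ?_ (Category.id_comp _).symm))
    · refine congrArg _ ((Category.id_comp _).trans ?_)
      exact congrArg _ (Category.id_comp _)
    · exact congrArg _ ((Category.id_comp _).trans (Category.comp_id _)).symm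
  coh_unit := by
    refine ObjectProperty.hom_ext _ (NatTrans.ext (funext fun X => ?_))
    have h := hG.unit_comparison X
    exact (congrArg _ (Category.id_comp _)).trans (h.trans
      ((Category.id_comp _).trans (Category.comp_id _)).symm)

end PointCat

/-! ### Transport of the outer projection along an equivalence C ≌ X × Y -/

section EquivalenceWithProduct

open scoped CategoryTheory.Prod

variable {C : Type u₁} [Category.{v₁} C] {X : Type u₂} [Category.{v₂} X] {Y : Type u₃}
  [Category.{v₃} Y] (E : C ≌ X × Y)

/-- The rectangular band structure on a category equivalent to a product `X × Y`, transported from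
the projection `(X × Y) × (X × Y) ⥤ X × Y` on the outer components. -/
def bandFunctor : C × C ⥤ C :=
  E.functor.prod E.functor ⋙
    (CategoryTheory.Prod.fst X Y).prod (CategoryTheory.Prod.snd X Y) ⋙ E.inverse

/-- The unit of `bandFunctor`. -/
def bandUnit : 𝟭 C ≅ Functor.diag C ⋙ bandFunctor E := E.unitIso

/-- The counit of `E` at the outer components. -/
def bandCounit (a b : C) : E.functor.obj ((bandFunctor E).obj (a, b)) ≅
    ((E.functor.obj a).1, (E.functor.obj b).2) :=
  E.counitIso.app ((E.functor.obj a).1, (E.functor.obj b).2)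

/-- The components of the multiplication of `bandFunctor`, before applying `E.inverse`. -/
def bandMultIso (a b c d : C) :
    ((E.functor.obj ((bandFunctor E).obj (a, b))).1,
        (E.functor.obj ((bandFunctor E).obj (c, d))).2) ≅
      ((E.functor.obj a).1, (E.functor.obj d).2) :=
  Iso.prod
    ((CategoryTheory.Prod.fst X Y).mapIso (Y := ((E.functor.obj a).1, (E.functor.obj b).2))
      (bandCounit E a b))
    ((CategoryTheory.Prod.snd X Y).mapIso (Y := ((E.functor.obj c).1, (E.functor.obj d).2))
      (bandCounit E c d))

/-- The multiplication of `bandFunctor`. -/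
def bandMult : (bandFunctor E).prod (bandFunctor E) ⋙ bandFunctor E ≅
    (CategoryTheory.Prod.fst C C).prod (CategoryTheory.Prod.snd C C) ⋙ bandFunctor E :=
  NatIso.ofComponents
    (fun Z => E.inverse.mapIso (bandMultIso E Z.1.1 Z.1.2 Z.2.1 Z.2.2))
    (fun {Z W} g => by
      refine (E.inverse.map_comp _ _).symm.trans (Eq.trans ?_ (E.inverse.map_comp _ _))
      refine congrArg _ (Prod.ext ?_ ?_)
      · exact congr(($(E.counitIso.hom.naturality
          ((E.functor.map g.1.1).1 ×ₘ (E.functor.map g.1.2).2))).1)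
      · exact congr(($(E.counitIso.hom.naturality
          ((E.functor.map g.2.1).1 ×ₘ (E.functor.map g.2.2).2))).2))

/-- Both sides are images under `E.inverse`. In X × Y, each component is a component of a naturality
square of the counit, taken at a morphism assembled from counit components. -/
theorem bandMult_assoc (Z : ((C × C) × (C × C)) × ((C × C) × (C × C))) :
    (bandFunctor E).map ((bandMult E).hom.app Z.1 ×ₘ (bandMult E).hom.app Z.2) ≫
      (bandMult E).hom.app ((Z.1.1.1, Z.1.2.2), (Z.2.1.1, Z.2.2.2)) =
    (bandMult E).hom.app (((bandFunctor E).obj Z.1.1, (bandFunctor E).obj Z.1.2),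
        ((bandFunctor E).obj Z.2.1, (bandFunctor E).obj Z.2.2)) ≫
      (bandMult E).hom.app (Z.1.1, Z.2.2) := by
  refine (E.inverse.map_comp _ _).symm.trans (Eq.trans ?_ (E.inverse.map_comp _ _))
  refine congrArg _ (Prod.ext ?_ ?_)
  · exact congr(($(E.counitIso.hom.naturality
      ((E.counitIso.hom.app ((E.functor.obj Z.1.1.1).1, (E.functor.obj Z.1.1.2).2)).1 ×ₘ
        (E.counitIso.hom.app ((E.functor.obj Z.1.2.1).1, (E.functor.obj Z.1.2.2).2)).2))).1)
  · exact congr(($(E.counitIso.hom.naturality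
      ((E.counitIso.hom.app ((E.functor.obj Z.2.1.1).1, (E.functor.obj Z.2.1.2).2)).1 ×ₘ
        (E.counitIso.hom.app ((E.functor.obj Z.2.2.1).1, (E.functor.obj Z.2.2.2).2)).2))).2)

theorem bandMult_left_unit (Z : C × C) :
    (bandUnit E).hom.app ((bandFunctor E).obj Z) ≫ (bandMult E).hom.app (Z, Z) = 𝟙 _ :=
  E.unit_inverse_comp
    ((E.functor.obj Z.1).1, (E.functor.obj Z.2).2)

/-- This is the triangle identity in X × Y, read componentwise; the left unit law is the other
triangle identity. -/
theorem bandMult_right_unit (Z : C × C) :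
    (bandFunctor E).map ((bandUnit E).hom.app Z.1 ×ₘ (bandUnit E).hom.app Z.2) ≫
      (bandMult E).hom.app ((Z.1, Z.1), (Z.2, Z.2)) = 𝟙 _ := by
  refine (E.inverse.map_comp _ _).symm.trans (Eq.trans ?_ (E.inverse.map_id _))
  refine congrArg _ (Prod.ext ?_ ?_)
  · exact congr(($(E.functor_unitIso_comp Z.1)).1)
  · exact congr(($(E.functor_unitIso_comp Z.2)).2)

theorem bandFunctor_preservesZeroObjects [HasZeroObject C] :
    PreservesZeroObjects _ _ (bandFunctor E) := by
  intro Z hZ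
  obtain ⟨h₁, h₂⟩ := (isZero_prod_iff Z).1 hZ
  -- A zero pair (a, b) is isomorphic to (a, a), and Q(a, a) ≅ a; no zero objects in X or Y are
  -- needed.
  have e : (bandFunctor E).obj Z ≅ Z.1 :=
    (bandFunctor E).mapIso (Iso.prod (Iso.refl Z.1) (h₂.iso h₁)) ≪≫ ((bandUnit E).app Z.1).symm
  exact h₁.of_iso e

end EquivalenceWithProduct

namespace PointCat

open TwoMonad

/-- The pseudo-algebra on a pointed category equivalent to a product. -/
def ofEquivalence (C : PointCat.{v, u}) {X : Type u₂} [Category.{v₂} X] {Y : Type u₃}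
    [Category.{v₃} Y] (E : C.carrier ≌ X × Y) : PseudoAlgebra squareMonad.{v, u} where
  carrier := C
  act := ⟨bandFunctor E, bandFunctor_preservesZeroObjects E⟩
  actMu := ObjectProperty.isoMk _ (bandMult E)
  actEta := ObjectProperty.isoMk _ (bandUnit E)
  coh_assoc := by
    refine ObjectProperty.hom_ext _ (NatTrans.ext (funext fun Z => ?_))
    refine Eq.trans ?_ ((bandMult_assoc E Z).trans ?_)
    · exact congrArg _ (Category.id_comp _)
    · refine Eq.symm ((Category.id_comp _).trans (congrArg _ ?_))
      exact (Category.id_comp _).trans (Category.comp_id _)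
  coh_unit_left := by
    refine ObjectProperty.hom_ext _ (NatTrans.ext (funext fun Z => ?_))
    exact (congrArg _ (Category.id_comp _)).trans (bandMult_left_unit E Z)
  coh_unit_right := by
    refine ObjectProperty.hom_ext _ (NatTrans.ext (funext fun Z => ?_))
    exact (congrArg _ (Category.id_comp _)).trans (bandMult_right_unit E Z)

end PointCat

/-! ### The 2-functors χ and ξ and the 2-natural isomorphisms -/

theorem PretorsionTheory.isMorphism_id_of_iff {C : Type u} [Category.{v} C]
    {P P' : PretorsionTheory C} (hT : ∀ X, P.tors X ↔ P'.tors X)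
    (hF : ∀ X, P.free X ↔ P'.free X) : IsMorphism P P' (𝟭 C) where
  map_tors X := (hT X).1
  map_free X := (hF X).1
  map_exact X := by
    have h : P.tors ⊓ P.free = P'.tors ⊓ P'.free :=
      congrArg₂ _ (funext fun X => propext (hT X)) (funext fun X => propext (hF X))
    have h' : IsShortExact (factorsThrough (P.tors ⊓ P.free)) (P.l X) (P.r X) := P.exact X
    rw [h] at h'
    exact h'

namespace TwoMonad.PseudoMorphism

variable {B : Type u} [Bicategory.{w, v} B] [Strict B] {M : TwoMonad B} {A A' : M.PseudoAlgebra}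

theorem comp_eqToHom_eq_eqToHom_comp {f g h k : PseudoMorphism M A A'} {α : f ⟶ g} {β : h ⟶ k}
    {e : g = k} {e' : f = h}
    (H : α.cell ≫ eqToHom (by rw [e]) = eqToHom (by rw [e']) ≫ β.cell) :
    α ≫ eqToHom e = eqToHom e' ≫ β := by
  subst e e'
  exact Hom₂.ext (by simpa using H)

theorem eq_eqToHom_comp_comp_eqToHom {f g h k : PseudoMorphism M A A'} {α : f ⟶ g} {β : h ⟶ k}
    {e : k = g} {e' : f = h}
    (H : α.cell = eqToHom (by rw [e']) ≫ β.cell ≫ eqToHom (by rw [e])) :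
    α = eqToHom e' ≫ β ≫ eqToHom e := by
  subst e e'
  exact Hom₂.ext (by simpa using H)

end TwoMonad.PseudoMorphism

namespace TorR

open TwoMonad PointCat
open scoped CategoryTheory.Prod

theorem null_iff (P : TorR.{v, u}) {X Y : P.base.carrier} (g : X ⟶ Y) : P.theory.null g ↔ g = 0 :=
  factorsThrough_iff_eq_zero P.tors_and_free_iff g

/-- Torsion means that the torsion-free part is zero. The condition is phrased on the second
component of Γ(0), so that it can be compared with Γ(t). -/
theorem tors_iff (P : TorR.{v, u}) (X : P.base.carrier) :
    P.theory.tors X ↔ P.theory.mapF (0 : X ⟶ X) = 𝟙 _ := by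
  constructor
  · intro h
    obtain ⟨e, he⟩ := P.theory.l_of_tors X h
    have hr := (P.null_iff _).1 (P.theory.exact X).isKernel.1
    refine (P.theory.eq_mapF ?_).symm
    rw [Category.comp_id, zero_comp, ← cancel_epi (eqToHom e), ← he, hr, comp_zero]
  · intro h
    have hr : P.theory.r X = 0 := by
      rw [← Category.comp_id (P.theory.r X), ← h, P.theory.r_mapF, zero_comp]
    -- With r = 0 the identity factors through the kernel l, which is therefore invertible;
    -- repleteness concludes.
    obtain ⟨w, hw, -⟩ := (P.theory.exact X).isKernel.2 (𝟙 X)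
      ((P.null_iff _).2 (by rw [hr, comp_zero]))
    have hw' : P.theory.l X ≫ w = 𝟙 _ :=
      ((P.theory.exact X).isKernel.2 _ (P.theory.exact X).isKernel.1).unique
        (by simp [hw]) (by simp)
    exact P.theory.tors_replete.of_iso ⟨P.theory.l X, w, hw', hw⟩ (P.theory.tors_T X)

theorem free_iff (P : TorR.{v, u}) (X : P.base.carrier) :
    P.theory.free X ↔ P.theory.mapT (0 : X ⟶ X) = 𝟙 _ := by
  constructor
  · intro h
    obtain ⟨e, he⟩ := P.theory.r_of_free X h
    have hr := (P.null_iff _).1 (P.theory.exact X).isKernel.1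
    refine (P.theory.eq_mapT ?_).symm
    rw [Category.id_comp, comp_zero, ← cancel_mono (eqToHom e), ← he, hr, zero_comp]
  · intro h
    have hl : P.theory.l X = 0 := by
      rw [← Category.id_comp (P.theory.l X), ← h, P.theory.mapT_l, comp_zero]
    obtain ⟨w, hw, -⟩ := (P.theory.exact X).isCokernel.2 (𝟙 X)
      ((P.null_iff _).2 (by rw [hl, zero_comp]))
    have hw' : w ≫ P.theory.r X = 𝟙 _ :=
      ((P.theory.exact X).isCokernel.2 _ (P.theory.exact X).isCokernel.1).unique
        (by simp [reassoc_of% hw]) (by simp)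
    exact P.theory.free_replete.of_iso ⟨w, P.theory.r X, hw', hw⟩ (P.theory.free_F X)

/-- The equivalence `C ≌ 𝒯 × ℱ` of a rectangular torsion theory. -/
noncomputable def equivalence (P : TorR.{v, u}) :
    P.base.carrier ≌ P.theory.tors.FullSubcategory × P.theory.free.FullSubcategory :=
  haveI : P.theory.Γ.IsEquivalence := P.isRectangular
  P.theory.Γ.asEquivalence

/-- The pseudo-algebra of a rectangular torsion theory. -/
noncomputable def toPseudoAlgebra (P : TorR.{v, u}) : PseudoAlgebra squareMonad.{v, u} :=
  ofEquivalence P.base P.equivalence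

/-- Fullness supplies k whose image under Γ is the mixed pair. Then `glue g h` is the conjugate by
the unit of the equivalence of the image of k under Γ and its inverse, and naturality of the unit
identifies it with k. -/
theorem Γ_map_glue (P : TorR.{v, u}) {X Y : P.base.carrier} (g h : X ⟶ Y) :
    P.theory.Γ.map ((band P.toPseudoAlgebra).glue g h) =
      ((P.theory.Γ.map g).1, (P.theory.Γ.map h).2) := by
  obtain ⟨k, hk⟩ := P.equivalence.functor.map_surjective
    (X := X) (Y := Y) ((P.theory.Γ.map g).1, (P.theory.Γ.map h).2)
  have e : (band P.toPseudoAlgebra).glue g h = k := by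
    have h₁ : (band P.toPseudoAlgebra).map g h = P.equivalence.inverse.map
      (P.equivalence.functor.map k) :=
      congrArg P.equivalence.inverse.map hk.symm
    have h₂ := P.equivalence.unitIso.hom.naturality k
    refine (Category.assoc _ _ _).symm.trans ((Iso.comp_inv_eq _).2 ?_)
    exact (congrArg _ h₁).trans h₂.symm
  rw [e]
  exact hk

theorem isTorsion_iff (P : TorR.{v, u}) (X : P.base.carrier) :
    P.theory.tors X ↔ (band P.toPseudoAlgebra).IsTorsion X := by
  have hΓ : P.theory.Γ.IsEquivalence := P.isRectangular
  have e := P.Γ_map_glue (𝟙 X) 0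
  rw [tors_iff]
  constructor
  · intro h
    refine P.theory.Γ.map_injective (e.trans ?_)
    exact Prod.ext rfl ((ObjectProperty.hom_ext _ h).trans
      congr(($(P.theory.Γ.map_id X)).2).symm)
  · intro h
    have h' := e.symm.trans (congrArg P.theory.Γ.map h)
    exact congr(($h').2.hom).trans congr(($(P.theory.Γ.map_id X)).2.hom)

theorem isTorsionFree_iff (P : TorR.{v, u}) (X : P.base.carrier) :
    P.theory.free X ↔ (band P.toPseudoAlgebra).IsTorsionFree X := by
  have hΓ : P.theory.Γ.IsEquivalence := P.isRectangular
  have e := P.Γ_map_glue 0 (𝟙 X)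
  rw [free_iff]
  constructor
  · intro h
    refine P.theory.Γ.map_injective (e.trans ?_)
    exact Prod.ext ((ObjectProperty.hom_ext _ h).trans
      congr(($(P.theory.Γ.map_id X)).1).symm) rfl
  · intro h
    have h' := e.symm.trans (congrArg P.theory.Γ.map h)
    exact congr(($h').1.hom).trans congr(($(P.theory.Γ.map_id X)).1.hom)

/-- The rectangular torsion theory of a pseudo-algebra. -/
noncomputable def ofPseudoAlgebra (A : PseudoAlgebra squareMonad.{v, u}) : TorR.{v, u} where
  base := A.carrier
  theory := (band A).theory
  isRectangular := (band A).theory_isRectangular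
  tors_and_free_iff := (band A).isTorsion_and_isTorsionFree_iff

/-- The identity functor, from a rectangular torsion theory to the one of its pseudo-algebra. -/
noncomputable def unitHom (P : TorR.{v, u}) : P ⟶ ofPseudoAlgebra P.toPseudoAlgebra :=
  ⟨𝟭 P.base.carrier, PretorsionTheory.isMorphism_id_of_iff
    (P' := (band P.toPseudoAlgebra).theory) P.isTorsion_iff P.isTorsionFree_iff⟩

/-- The identity functor, to a rectangular torsion theory from the one of its pseudo-algebra. -/
noncomputable def unitInv (P : TorR.{v, u}) : ofPseudoAlgebra P.toPseudoAlgebra ⟶ P :=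
  ⟨𝟭 P.base.carrier, PretorsionTheory.isMorphism_id_of_iff (P := (band P.toPseudoAlgebra).theory)
    (fun X => (P.isTorsion_iff X).symm) (fun X => (P.isTorsionFree_iff X).symm)⟩

/-- The pseudo-morphism of a morphism between the rectangular torsion theories of two
pseudo-algebras. -/
noncomputable def pseudoMorphismOfHom {A A' : PseudoAlgebra squareMonad.{v, u}}
    (G : ofPseudoAlgebra A ⟶ ofPseudoAlgebra A') : PseudoMorphism squareMonad A A' :=
  pseudoMorphismMk (A := A) (A' := A') (forget.map G) (RectBand.isMorphism_theory_iff.1 G.property)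

/-- The morphism of rectangular torsion theories of a pseudo-morphism. -/
noncomputable def homOfPseudoMorphism {A A' : PseudoAlgebra squareMonad.{v, u}}
    (G : PseudoMorphism squareMonad A A') : ofPseudoAlgebra A ⟶ ofPseudoAlgebra A' :=
  ⟨G.hom.obj, RectBand.isMorphism_theory_iff.2 (commutes_of_pseudoMorphism G)⟩

/-- The 2-functor from rectangular torsion theories to pseudo-algebras. -/
noncomputable def χ : StrictPseudofunctor TorR.{v, u} (PseudoAlgebra squareMonad.{v, u}) :=
  StrictPseudofunctor.mk'' {
    obj P := P.toPseudoAlgebra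
    -- Conjugation by `unitInv` and `unitHom` leaves the functor unchanged but makes source and
    -- target theories of bands, where being a morphism means commuting with t and f.
    map {P Q} G := pseudoMorphismOfHom (P.unitInv ≫ G ≫ Q.unitHom)
    map₂ {P Q G H} α := homMk₂ (G := pseudoMorphismOfHom (P.unitInv ≫ G ≫ Q.unitHom))
      (H := pseudoMorphismOfHom (P.unitInv ≫ H ≫ Q.unitHom))
      (ObjectProperty.homMk α.hom)
    map_id _ := pseudoMorphism_ext rfl
    map_comp _ _ := pseudoMorphism_ext rfl
    map₂_id _ := PseudoMorphism.Hom₂.ext rfl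
    map₂_comp _ _ := PseudoMorphism.Hom₂.ext rfl
    map₂_whisker_left _ _ _ _ := PseudoMorphism.eq_eqToHom_comp_comp_eqToHom
      ((Category.id_comp _).trans (Category.comp_id _)).symm
    map₂_whisker_right _ _ := PseudoMorphism.eq_eqToHom_comp_comp_eqToHom
      ((Category.id_comp _).trans (Category.comp_id _)).symm }

/-- The 2-functor from pseudo-algebras to rectangular torsion theories. -/
noncomputable def ξ : StrictPseudofunctor (PseudoAlgebra squareMonad.{v, u}) TorR.{v, u} :=
  StrictPseudofunctor.mk'' {
    obj A := ofPseudoAlgebra A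
    map G := homOfPseudoMorphism G
    map₂ {A A' G H} α := ObjectProperty.homMk
      (PseudoMorphism.Hom₂.cell (A := A) (A' := A') (f := G) (g := H) α).hom
    map_id _ := rfl
    map_comp _ _ := rfl
    map₂_id _ := rfl
    map₂_comp _ _ := rfl
    map₂_whisker_left _ _ _ _ := ((Category.id_comp _).trans (Category.comp_id _)).symm
    map₂_whisker_right _ _ := ((Category.id_comp _).trans (Category.comp_id _)).symm }

/-- The 2-natural isomorphism `Id ≅ ξ ∘ χ`. -/
noncomputable def unitIso : TwoNatIso (StrictPseudofunctor.id TorR.{v, u}) (χ.comp ξ) where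
  hom :=
    { app P := P.unitHom
      naturality _ := rfl
      naturality₂ _ := (Category.comp_id _).trans (Category.id_comp _).symm }
  inv :=
    { app P := P.unitInv
      naturality _ := rfl
      naturality₂ _ := (Category.comp_id _).trans (Category.id_comp _).symm }
  hom_inv_id _ := rfl
  inv_hom_id _ := rfl

/-- The 2-natural isomorphism `χ ∘ ξ ≅ Id`. -/
noncomputable def counitIso :
    TwoNatIso (ξ.comp χ) (StrictPseudofunctor.id (PseudoAlgebra squareMonad.{v, u})) where
  hom :=
    -- The two actions on the same category may differ; the identity functor becomes a
    -- pseudo-morphism through its comparison cell.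
    { app A := pseudoMorphismOfHom (A := (ofPseudoAlgebra A).toPseudoAlgebra) (A' := A)
        (unitInv (ofPseudoAlgebra A))
      naturality _ := pseudoMorphism_ext rfl
      naturality₂ _ := PseudoMorphism.comp_eqToHom_eq_eqToHom_comp
        ((Category.comp_id _).trans (Category.id_comp _).symm) }
  inv :=
    { app A := pseudoMorphismOfHom (A := A) (A' := (ofPseudoAlgebra A).toPseudoAlgebra)
        (unitHom (ofPseudoAlgebra A))
      naturality _ := pseudoMorphism_ext rfl
      naturality₂ _ := PseudoMorphism.comp_eqToHom_eq_eqToHom_comp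
        ((Category.comp_id _).trans (Category.id_comp _).symm) }
  hom_inv_id _ := pseudoMorphism_ext rfl
  inv_hom_id _ := pseudoMorphism_ext rfl

end TorR

end RTT

theorem mainTheorem1 :
    Nonempty (RTT.TwoEquivalenceOver
      RTT.TorR.forget.{v, u} (RTT.TwoMonad.forget RTT.PointCat.squareMonad.{v, u})) :=
  ⟨{functor := RTT.TorR.χ
    inverse := RTT.TorR.ξ
    functor_over := RTT.strictPseudofunctor_ext rfl
    inverse_over := RTT.strictPseudofunctor_ext rfl
    unitIso := RTT.TorR.unitIso
    counitIso := RTT.TorR.counitIso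
    unit_over _ := ⟨rfl, rfl⟩
    counit_over _ := ⟨rfl, rfl⟩ }⟩
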